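/- **Syntax.** Let atoms $a,f$ be strings; names are variables $x$ and function identifiers $f/k$ ($k\in\mathbb N$). Terms of sequential Core Erlang are given by - patterns $p ::= i \mid a \mid x \mid [p_1|p_2] \mid [] \mid \{p_1,\dots,p_n\} \mid \sim\!\{p_1^k\Rightarrow p_1^v,\dots,p_n^k\Rightarrow p_n^v\}\!\sim$ (with $i\in\mathbb Z$); - function collections $ext$: lists of definitions $f/k=\mathtt{fun}(x_1,\dots,x_k)\to e$; clauses $cl ::= \langle p_1,\dots,p_n\rangle\ \mathtt{when}\ e^g\to e^b$; - values $v ::= i\mid a\mid x\mid f/k\mid clos(ext,[x_1,\dots,x_n],e)\mid[v_1|v_2]\mid[]\mid\{v_1,\dots,v_n\}\mid\sim\!\{v_1^k\Rightarrow v_1^v,\dots\}\!\sim$; - expressions $e ::= v\mid \mathtt{fun}(x_1,\dots,x_n)\to e\mid\langle e_1,\dots,e_n\rangle\mid[e_1|e_2]\mid\{e_1,\dots,e_n\}\mid\sim\!\{e_1^k\Rightarrow e_1^v,\dots\}\!\sim\mid\mathtt{call}\ e_m{:}e_f(e_1,\dots,e_n)\mid\mathtt{primop}\ a(e_1,\dots,e_n)\mid\mathtt{apply}\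 e(e_1,\dots,e_n)\mid\mathtt{case}\ e\ \mathtt{of}\ cl_1;\dots;cl_n\ \mathtt{end}\mid\mathtt{let}\ \langle x_1,\dots,x_n\rangle=e_1\ \mathtt{in}\ e_2\mid\mathtt{do}\ e_1\ e_2\mid\mathtt{letrec}\ ext\ \mathtt{in}\ e\mid\mathtt{try}\ e_1\ \mathtt{of}\ \langle x_1,\dots,x_k\rangle\to e_2\ \mathtt{catch}\ \langle y_1,\dots,y_n\rangle\to e_3$; - exceptions $exc=\{c,v_r,v_d\}^X$ with class $c\in\{\mathtt{throw},\mathtt{exit},\mathtt{error}\}$; results $res$ are value sequences $\langle v_1,\dots,v_n\rangle$ and exceptions; redexes $r$ are results, expressions, and the hole $\Box$. A scope $\Gamma$ is a set of names; $\Gamma\vdash t$ means that all free names of $t$ belong to $\Gamma$, and $t$ is closed if $\emptyset\vdash t$. Substitutions $\sigma$ map names to values and are applied in parallel and without capture ($t[\sigma]$); $\Gamma\vdash\sigma\multimap\Delta$ means $\Delta\vdash\sigma(x)$ for all $x\in\Gamma$. For a function collection $ext$, let $mk(ext)$ map each $f/k$ defined in $ext$ by $\mathtt{fun}(x_1,\dots,x_k)\to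 e$ to $clos(ext,[x_1,\dots,x_k],e)$. **Semantics.** A frame $F$ is one of $id(v_1,\dots,v_{i-1},\Box,e_{i+1},\dots,e_n)$ with $id\in\{tuple,values,map,call(v_m,v_f),primop(a),app(v)\}$, $[e_1|\Box]$, $[\Box|v_2]$, $\mathtt{call}\ \Box{:}e_f(\bar e)$, $\mathtt{call}\ v_m{:}\Box(\bar e)$, $\mathtt{apply}\ \Box(\bar e)$, $\mathtt{case}\ \Box\ \mathtt{of}\ \overline{cl}$, $\mathtt{case}\ vs\ \mathtt{of}\ ps\ \mathtt{when}\ \Box\to e^b;\overline{cl}$, $\mathtt{let}\ \langle\bar x\rangle=\Box\ \mathtt{in}\ e_2$, $\mathtt{do}\ \Box\ e_2$, $\mathtt{try}\ \Box\ \mathtt{of}\ \langle\bar x\rangle\to e_2\ \mathtt{catch}\ \langle\bar y\rangle\to e_3$; a frame stack $K$ is a list of frames, $\varepsilon$ the empty one. A frame is closed if filling its hole with a closed expression gives a closed expression (in the frame $\mathtt{case}\ vs\ \mathtt{of}\ ps\ \mathtt{when}\ \Box\to e^b;\dots$ the variables of $ps$ do not bind in $\Box$ and $e^b$); a stack is closed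 if its frames are. One-step reduction $\langle K,r\rangle\longrightarrow\langle K',r'\rangle$ is given by the following rules ($\bar e$, $\bar v$, $\overline{cl}$ denote lists). - Pushing a frame: $[e_1|e_2]$, $\mathtt{let}$, $\mathtt{do}$, $\mathtt{apply}$, $\mathtt{call}$, $\mathtt{case}$ and $\mathtt{try}$ push the frames $[e_1|\Box]$, $\mathtt{let}\ \langle\bar x\rangle=\Box\ \mathtt{in}\ e_2$, $\mathtt{do}\ \Box\ e_2$, $\mathtt{apply}\ \Box(\bar e)$, $\mathtt{call}\ \Box{:}e_f(\bar e)$, $\mathtt{case}\ \Box\ \mathtt{of}\ \overline{cl}$, $\mathtt{try}\ \Box\ \mathtt{of}\dots$ and continue with the expression that stood in place of $\Box$. $\mathtt{primop}\ a(\bar e)$, $\langle\bar e\rangle$, $\{\bar e\}$ push $id(\Box,\bar e)$, for $id=primop(a),values,tuple$, and continue with $\Box$. $\sim\!\{e_1^k\Rightarrow e_1^v,\dots,e_n^k\Rightarrow e_n^v\}\!\sim$ with $n\ge1$ pushes $map(\Box,e_1^v,e_2^k,e_2^v,\dots,e_n^k,e_n^v)$ and continues with $e_1^k$. - Changing the top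 frame: $\langle[e_1|\Box]::K,\langle v\rangle\rangle\longrightarrow\langle[\Box|v]::K,e_1\rangle$; $\langle\mathtt{call}\ \Box{:}e_f(\bar e)::K,\langle v\rangle\rangle\longrightarrow\langle\mathtt{call}\ v{:}\Box(\bar e)::K,e_f\rangle$; $\langle\mathtt{call}\ v_m{:}\Box(\bar e)::K,\langle v\rangle\rangle\longrightarrow\langle call(v_m,v)(\Box,\bar e)::K,\Box\rangle$; $\langle\mathtt{apply}\ \Box(\bar e)::K,\langle v\rangle\rangle\longrightarrow\langle app(v)(\Box,\bar e)::K,\Box\rangle$; $\langle id(\Box,e_1,\bar e)::K,\Box\rangle\longrightarrow\langle id(\Box,\bar e)::K,e_1\rangle$ if $id\ne map$; $\langle id(\bar v,\Box,e,\bar e)::K,\langle v\rangle\rangle\longrightarrow\langle id(\bar v,v,\Box,\bar e)::K,e\rangle$. With $\mathtt{case}\ \Box\ \mathtt{of}\ (ps\ \mathtt{when}\ e^g\to e^b);\overline{cl}$ on top and redex $vs$: if $vs$ does not match $ps$, the first clause is dropped and the redex stays $vs$; if it matches with bindings $\theta$, the top frame becomes $\mathtt{case}\ vs\ \mathtt{of}\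 ps\ \mathtt{when}\ \Box\to e^b[\theta];\overline{cl}$ and the redex $e^g[\theta]$. With that last frame on top, the redex $\langle\mathtt{'false'}\rangle$ leads to the frame $\mathtt{case}\ \Box\ \mathtt{of}\ \overline{cl}$ and the redex $vs$. Patterns match values structurally; value sequences, tuples and maps match pairwise, at equal length. - Without a frame, or removing one: $\sim\!\{\}\!\sim$ gives the sequence of the empty map; $\mathtt{fun}(\bar x)\to e$ gives $\langle clos(\emptyset,[\bar x],e)\rangle$; $\mathtt{letrec}\ ext\ \mathtt{in}\ e$ gives $e[mk(ext)]$; a value $v$ gives $\langle v\rangle$; $\langle id(\bar v,\Box)::K,\Box\rangle\longrightarrow\langle K,eval(id,\bar v)\rangle$ if $id\ne map$; $\langle id(\bar v,\Box)::K,\langle v\rangle\rangle\longrightarrow\langle K,eval(id,(\bar v,v))\rangle$; $\langle[\Box|v_2]::K,\langle v_1\rangle\rangle\longrightarrow\langle K,\langle[v_1|v_2]\rangle\rangle$; the frame $\mathtt{case}\ vs\ \mathtt{of}\ ps\ \mathtt{when}\ \Box\to e^b;\dots$ with $\langle\mathtt{'true'}\rangle$ gives $e^b$; the frames $\mathtt{let}$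 and $\mathtt{try}$ with $\langle v_1,\dots,v_n\rangle$, where $n$ is the number of the variables $\bar x$, give $e_2[x_1\mapsto v_1,\dots,x_n\mapsto v_n]$; $\mathtt{do}\ \Box\ e_2$ with $\langle v\rangle$ gives $e_2$. - Exceptions: $\mathtt{case}\ \Box\ \mathtt{of}\ \emptyset$ with any $vs$ gives $\{error,if\_clause,\{\}\}^X$; a $\mathtt{try}$ frame with exactly three catch variables and $\{c,v_r,v_d\}^X$ gives $e_3[y_1\mapsto c,y_2\mapsto v_r,y_3\mapsto v_d]$; an exception removes every top frame that is not a $\mathtt{try}$ frame. Here $eval(tuple,\bar v)=\langle\{\bar v\}\rangle$; $eval(values,\bar v)=\langle\bar v\rangle$; $eval(map,(k_1,v_1,\dots,k_n,v_n))$ is the map of these pairs ordered by keys, the last of several equal keys counting (undefined for an odd number of parameters); $eval(app(clos(ext,[x_1,\dots,x_n],e)),(v_1,\dots,v_n))=e[mk(ext),x_1\mapsto v_1,\dots,x_n\mapsto v_n]$, and $eval(app(v),\bar v)$ is a $badfun$ or $badarity$ error exception otherwise; $eval(primop(a),\bar v)$ raises an error with reason $v$ for $a=\mathtt{match\_fail}$,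 $\bar v=v$, and an $undef$ error otherwise; $eval(call(v_m,v_f),\bar v)$ is a $badarg$ error unless $v_m,v_f$ are atoms, and otherwise the usual result of the Erlang function, for the following functions of module $\mathtt{erlang}$: $+,-$ (unary and binary), $*$, div, rem, bsl, bsr, abs, and, or, xor, not, $==$, $=:=$, $/=$, $=/=$, $<$, $=<$, $>$, $>=$, $++$, $--$, length, hd, tl, tuple\_to\_list, list\_to\_tuple, tuple\_size, element, setelement, map\_size, is\_number, is\_integer, is\_atom, is\_boolean, is\_list, is\_tuple, is\_map, is\_function, fun\_info (for arity), throw, exit, error, and for $\mathtt{lists{:}split}$; illegal arguments give a $badarg$ or $badarith$ error, and any other function an $undef$ error. Values are compared in the Erlang term order, in which two closures with the same number of parameters count as equal. Write $\langle K,r\rangle\Downarrow^n$ if $\langle K,r\rangle\longrightarrow^n\langle\varepsilon,res\rangle$ for some result $res$, and $\langle K,r\rangle\Downarrow$ if this holds for some $n$. **Logical relations.** For $n\in\mathbb N$ define relations between closed expressions ($\mathbb E_n$), closed values ($\mathbb V_n$), closed exceptions ($\mathbb X_n$), closed frame stacks ($\mathbb K_n$) and closed redexes ($\mathbb R_n$):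 - $(e_1,e_2)\in\mathbb E_n$ iff for all $m\le n$ and $(K_1,K_2)\in\mathbb K_m$: $\langle K_1,e_1\rangle\Downarrow^m$ implies $\langle K_2,e_2\rangle\Downarrow$; and $\mathbb R_n$ is defined in the same way for redexes. - $(K_1,K_2)\in\mathbb K_n$ iff for all $m\le n$: $\langle K_1,\langle v_1,\dots,v_k\rangle\rangle\Downarrow^m$ implies $\langle K_2,\langle v_1',\dots,v_k'\rangle\rangle\Downarrow$ whenever all $(v_i,v_i')\in\mathbb V_m$; $\langle K_1,exc_1\rangle\Downarrow^m$ implies $\langle K_2,exc_2\rangle\Downarrow$ whenever $(exc_1,exc_2)\in\mathbb X_m$; and $\langle K_1,\Box\rangle\Downarrow^m$ implies $\langle K_2,\Box\rangle\Downarrow$. - $\mathbb V_n$ relates equal integers, equal atoms, $[]$ with $[]$, and lists, tuples and maps of the same shape whose components are related by $\mathbb V_n$ position by position; moreover (terms being taken up to renaming of bound names) $(clos(ext,[x_1,\dots,x_k],e),clos(ext',[x_1',\dots,x_k'],e'))\in\mathbb V_n$ iff for all $m<n$ and all $(v_1,v_1'),\dots,(v_k,v_k')\in\mathbb V_m$ we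 have $(e[mk(ext),x_i\mapsto v_i],\,e'[mk(ext'),x_i'\mapsto v_i'])\in\mathbb E_m$. No other values are related. - $(\{c,v_r,v_d\}^X,\{c',v_r',v_d'\}^X)\in\mathbb X_n$ iff $c=c'$ and $(v_r,v_r'),(v_d,v_d')\in\mathbb V_n$. For a scope $\Gamma$, $(\sigma_1,\sigma_2)\in\mathbb G^\Gamma_n$ iff $\Gamma\vdash\sigma_1\multimap\emptyset$, $\Gamma\vdash\sigma_2\multimap\emptyset$ and $(\sigma_1(x),\sigma_2(x))\in\mathbb V_n$ for all $x\in\Gamma$. For each $\mathbb A\in\{\mathbb E,\mathbb V,\mathbb X,\mathbb R\}$ the open relation $\mathbb A^\Gamma$ is defined by: $(t_1,t_2)\in\mathbb A^\Gamma$ iff $(t_1[\sigma_1],t_2[\sigma_2])\in\mathbb A_n$ for all $n$ and all $(\sigma_1,\sigma_2)\in\mathbb G^\Gamma_n$. **Theorem (Fundamental property).** For every scope $\Gamma$: 1. for all expressions $e$, if $\Gamma\vdash e$ then $(e,e)\in\mathbb E^\Gamma$; 2. for all values $v$, if $\Gamma\vdash v$ then $(v,v)\in\mathbb V^\Gamma$;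 3. for all exceptions $exc$, if $\Gamma\vdash exc$ then $(exc,exc)\in\mathbb X^\Gamma$; 4. for all redexes $r$, if $\Gamma\vdash r$ then $(r,r)\in\mathbb R^\Gamma$; 5. for all substitutions $\sigma$ with $\Gamma\vdash\sigma\multimap\emptyset$ and all $n\in\mathbb N$, $(\sigma,\sigma)\in\mathbb G^\Gamma_n$. -/

import Mathlib

/-!
# Sequential Core Erlang: syntax, frame stack semantics, step-indexed logical relations
-/

namespace CoreErlang

/-! ## Syntax -/

/-- Atoms are strings of Unicode characters. -/
abbrev Atom := String

/-- The atom with the given list of character codes. -/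
def mkAtom (codes : List ℕ) : Atom := String.ofList (codes.map Char.ofNat)

/-- Variables. -/
abbrev Var := String

/-- Names: variables `x` and function identifiers `f/k`. -/
inductive Name where
  | var (x : Var)
  | fid (f : Atom) (k : ℕ)
  deriving DecidableEq

/-- Patterns. -/
inductive Pat where
  | int (i : ℤ)
  | atom (a : Atom)
  | var (x : Var)
  | cons (p₁ p₂ : Pat)
  | nil
  | tuple (ps : List Pat)
  | map (ps : List (Pat × Pat))

mutual

/-- Expressions are values or non-values. -/
inductive Exp where
  | val (v : Val)
  | nonval (n : NonVal)

/-- Values; `clos ext xs e` is the closure of `fun (xs) -> e` with the recursive function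
definitions `ext`. -/
inductive Val where
  | int (i : ℤ)
  | atom (a : Atom)
  | var (x : Var)
  | fid (f : Atom) (k : ℕ)
  | clos (ext : List ClosItem) (xs : List Var) (e : Exp)
  | cons (v₁ v₂ : Val)
  | nil
  | tuple (vs : List Val)
  | map (kvs : List (Val × Val))

/-- Non-value expressions. -/
inductive NonVal where
  | func (xs : List Var) (e : Exp)
  | values (es : List Exp)
  | cons (e₁ e₂ : Exp)
  | tuple (es : List Exp)
  | map (kvs : List (Exp × Exp))
  | call (em ef : Exp) (es : List Exp)
  | primop (a : Atom) (es : List Exp)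
  | app (e : Exp) (es : List Exp)
  | case (e : Exp) (cls : List Clause)
  | letIn (xs : List Var) (e₁ e₂ : Exp)
  | seq (e₁ e₂ : Exp)
  | letrec (ext : List ClosItem) (e : Exp)
  | tryCatch (e₁ : Exp) (xs : List Var) (e₂ : Exp) (ys : List Var) (e₃ : Exp)

/-- `mk f xs e` is the function definition `f/k = fun (xs) -> e`, where `k` is the length of
`xs`. -/
inductive ClosItem where
  | mk (f : Atom) (xs : List Var) (e : Exp)

/-- `mk ps eg eb` is the clause `<ps> when eg -> eb`. -/
inductive Clause where
  | mk (ps : List Pat) (eg eb : Exp)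

end

/-- Exception classes. -/
inductive ExcClass where
  | throw
  | exit
  | error
  deriving DecidableEq

/-- Exceptions: class, reason, details. -/
structure Exc where
  cls : ExcClass
  reason : Val
  details : Val

/-- Redexes: value sequences, exceptions, expressions, and the hole. -/
inductive Redex where
  | vals (vs : List Val)
  | exc (x : Exc)
  | exp (e : Exp)
  | box

/-- Results of an evaluation: value sequences and exceptions. -/
inductive Redex.IsResult : Redex → Prop where
  | vals (vs : List Val) : IsResult (.vals vs)
  | exc (x : Exc) : IsResult (.exc x)

/-- Identifiers of parameter list frames. -/
inductive FrameId where
  | tuple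
  | values
  | map
  | call (vm vf : Val)
  | primop (a : Atom)
  | app (vf : Val)

/-- Frames. -/
inductive Frame where
  /-- `id(vs, □, es)` -/
  | params (id : FrameId) (vs : List Val) (es : List Exp)
  /-- `[e₁ | □]` -/
  | consTail (e₁ : Exp)
  /-- `[□ | v₂]` -/
  | consHead (v₂ : Val)
  /-- `call □:ef(es)` -/
  | callMod (ef : Exp) (es : List Exp)
  /-- `call vm:□(es)` -/
  | callFun (vm : Val) (es : List Exp)
  /-- `apply □(es)` -/
  | app (es : List Exp)
  /-- `case □ of cls end` -/
  | case (cls : List Clause)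
  /-- `case vs of <ps> when □ -> eb; cls end` -/
  | caseGuard (vs : List Val) (ps : List Pat) (eb : Exp) (cls : List Clause)
  /-- `let <xs> = □ in e₂` -/
  | letIn (xs : List Var) (e₂ : Exp)
  /-- `do □ e₂` -/
  | seq (e₂ : Exp)
  /-- `try □ of <xs> -> e₂ catch <ys> -> e₃` -/
  | tryCatch (xs : List Var) (e₂ : Exp) (ys : List Var) (e₃ : Exp)

/-- Frame stacks, with the top frame first. -/
abbrev FrameStack := List Frame

/-! ## Bound names and scoping -/

mutual

/-- The variables of a pattern. -/
def Pat.vars : Pat → List Var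
  | .int _ => []
  | .atom _ => []
  | .var x => [x]
  | .cons p₁ p₂ => p₁.vars ++ p₂.vars
  | .nil => []
  | .tuple ps => patsVars ps
  | .map ps => patPairsVars ps

/-- The variables of a list of patterns. -/
def patsVars : List Pat → List Var
  | [] => []
  | p :: ps => p.vars ++ patsVars ps

/-- The variables of a list of pairs of patterns. -/
def patPairsVars : List (Pat × Pat) → List Var
  | [] => []
  | (p, q) :: ps => p.vars ++ (q.vars ++ patPairsVars ps)

end

/-- The variables `xs` as names. -/
def varNames (xs : List Var) : List Name := xs.map Name.var

/-- The function identifier that a function definition binds. -/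
def ClosItem.name : ClosItem → Name
  | .mk f xs _ => .fid f xs.length

/-- The function identifiers that a list of function definitions binds. -/
def namesOf (ext : List ClosItem) : List Name := ext.map ClosItem.name

/-- The scope `Γ` extended with the names `ns`. -/
def extend (Γ : Set Name) (ns : List Name) : Set Name := Γ ∪ {n | n ∈ ns}

mutual

/-- `e.Scoped Γ`: all free names of `e` belong to `Γ`. -/
def Exp.Scoped : Exp → Set Name → Prop
  | .val v, Γ => v.Scoped Γ
  | .nonval n, Γ => n.Scoped Γ

/-- All free names of a value belong to `Γ`. -/
def Val.Scoped : Val → Set Name → Prop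
  | .int _, _ => True
  | .atom _, _ => True
  | .var x, Γ => Name.var x ∈ Γ
  | .fid f k, Γ => Name.fid f k ∈ Γ
  | .clos ext xs e, Γ =>
      extScoped ext (extend Γ (namesOf ext)) ∧
        e.Scoped (extend (extend Γ (namesOf ext)) (varNames xs))
  | .cons v₁ v₂, Γ => v₁.Scoped Γ ∧ v₂.Scoped Γ
  | .nil, _ => True
  | .tuple vs, Γ => valsScoped vs Γ
  | .map kvs, Γ => valPairsScoped kvs Γ

/-- All free names of a non-value belong to `Γ`. -/
def NonVal.Scoped : NonVal → Set Name → Prop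
  | .func xs e, Γ => e.Scoped (extend Γ (varNames xs))
  | .values es, Γ => expsScoped es Γ
  | .cons e₁ e₂, Γ => e₁.Scoped Γ ∧ e₂.Scoped Γ
  | .tuple es, Γ => expsScoped es Γ
  | .map kvs, Γ => expPairsScoped kvs Γ
  | .call em ef es, Γ => em.Scoped Γ ∧ ef.Scoped Γ ∧ expsScoped es Γ
  | .primop _ es, Γ => expsScoped es Γ
  | .app e es, Γ => e.Scoped Γ ∧ expsScoped es Γ
  | .case e cls, Γ => e.Scoped Γ ∧ clausesScoped cls Γ
  | .letIn xs e₁ e₂, Γ => e₁.Scoped Γ ∧ e₂.Scoped (extend Γ (varNames xs))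
  | .seq e₁ e₂, Γ => e₁.Scoped Γ ∧ e₂.Scoped Γ
  | .letrec ext e, Γ =>
      extScoped ext (extend Γ (namesOf ext)) ∧ e.Scoped (extend Γ (namesOf ext))
  | .tryCatch e₁ xs e₂ ys e₃, Γ =>
      e₁.Scoped Γ ∧ e₂.Scoped (extend Γ (varNames xs)) ∧ e₃.Scoped (extend Γ (varNames ys))

/-- All expressions of the list are scoped. -/
def expsScoped : List Exp → Set Name → Prop
  | [], _ => True
  | e :: es, Γ => e.Scoped Γ ∧ expsScoped es Γ

/-- All expressions of the list of pairs are scoped. -/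
def expPairsScoped : List (Exp × Exp) → Set Name → Prop
  | [], _ => True
  | (k, e) :: kvs, Γ => k.Scoped Γ ∧ e.Scoped Γ ∧ expPairsScoped kvs Γ

/-- All values of the list are scoped. -/
def valsScoped : List Val → Set Name → Prop
  | [], _ => True
  | v :: vs, Γ => v.Scoped Γ ∧ valsScoped vs Γ

/-- All values of the list of pairs are scoped. -/
def valPairsScoped : List (Val × Val) → Set Name → Prop
  | [], _ => True
  | (k, v) :: kvs, Γ => k.Scoped Γ ∧ v.Scoped Γ ∧ valPairsScoped kvs Γ

/-- All function definitions are scoped in `Γ`, which already contains the names that the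
whole collection binds. -/
def extScoped : List ClosItem → Set Name → Prop
  | [], _ => True
  | .mk _ xs e :: ext, Γ => e.Scoped (extend Γ (varNames xs)) ∧ extScoped ext Γ

/-- All clauses are scoped. -/
def clausesScoped : List Clause → Set Name → Prop
  | [], _ => True
  | .mk ps eg eb :: cls, Γ =>
      eg.Scoped (extend Γ (varNames (patsVars ps))) ∧
        eb.Scoped (extend Γ (varNames (patsVars ps))) ∧ clausesScoped cls Γ

end

/-- All free names of an exception belong to `Γ`. -/
def Exc.Scoped (x : Exc) (Γ : Set Name) : Prop := x.reason.Scoped Γ ∧ x.details.Scoped Γ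

/-- All free names of a redex belong to `Γ`. -/
def Redex.Scoped : Redex → Set Name → Prop
  | .vals vs, Γ => valsScoped vs Γ
  | .exc x, Γ => x.Scoped Γ
  | .exp e, Γ => e.Scoped Γ
  | .box, _ => True

/-- The values in a frame identifier are closed. -/
def FrameId.Closed : FrameId → Prop
  | .tuple => True
  | .values => True
  | .map => True
  | .call vm vf => vm.Scoped ∅ ∧ vf.Scoped ∅
  | .primop _ => True
  | .app vf => vf.Scoped ∅

/-- A frame is closed if filling its hole with a closed expression gives a closed expression.
In `caseGuard` the pattern variables have already been substituted in the body. -/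
def Frame.Closed : Frame → Prop
  | .params id vs es => id.Closed ∧ valsScoped vs ∅ ∧ expsScoped es ∅
  | .consTail e₁ => e₁.Scoped ∅
  | .consHead v₂ => v₂.Scoped ∅
  | .callMod ef es => ef.Scoped ∅ ∧ expsScoped es ∅
  | .callFun vm es => vm.Scoped ∅ ∧ expsScoped es ∅
  | .app es => expsScoped es ∅
  | .case cls => clausesScoped cls ∅
  | .caseGuard vs _ eb cls => valsScoped vs ∅ ∧ eb.Scoped ∅ ∧ clausesScoped cls ∅
  | .letIn xs e₂ => e₂.Scoped (extend ∅ (varNames xs))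
  | .seq e₂ => e₂.Scoped ∅
  | .tryCatch xs e₂ ys e₃ =>
      e₂.Scoped (extend ∅ (varNames xs)) ∧ e₃.Scoped (extend ∅ (varNames ys))

/-- A frame stack is closed if all of its frames are. -/
def StackClosed (K : FrameStack) : Prop := ∀ F ∈ K, F.Closed

/-! ## Parallel substitution -/

/-- A name as a value. -/
def Val.ofName : Name → Val
  | .var x => .var x
  | .fid f k => .fid f k

/-- Substitutions map names to values; a name is left alone if it is mapped to itself. -/
abbrev Subst := Name → Val

/-- The substitution that leaves the names `ns` alone and agrees with `σ` elsewhere. -/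
def Subst.hide (σ : Subst) (ns : List Name) : Subst :=
  fun x => if x ∈ ns then Val.ofName x else σ x

/-- The substitution of a list of bindings, the identity on the names that are not bound.
The names that one construct of the language binds are distinct in a legal program; in
other programs the first binding counts. -/
def Subst.ofList (θ : List (Name × Val)) : Subst :=
  fun x => (θ.lookup x).getD (Val.ofName x)

/-- The bindings `x₁ ↦ v₁, …, xₙ ↦ vₙ`. -/
def bindVars (xs : List Var) (vs : List Val) : List (Name × Val) := (varNames xs).zip vs

mutual

/-- Applying a substitution. A substitution does not act on the names that are bound at a
position. Only closed values are ever substituted below (closing substitutions, and the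
reductions of closed configurations), so that no name can be captured. -/
def Exp.subst : Exp → Subst → Exp
  | .val v, σ => .val (v.subst σ)
  | .nonval n, σ => .nonval (n.subst σ)

/-- Applying a substitution to a value. -/
def Val.subst : Val → Subst → Val
  | .int i, _ => .int i
  | .atom a, _ => .atom a
  | .var x, σ => σ (.var x)
  | .fid f k, σ => σ (.fid f k)
  | .clos ext xs e, σ =>
      .clos (extSubst ext (σ.hide (namesOf ext))) xs
        (e.subst ((σ.hide (namesOf ext)).hide (varNames xs)))
  | .cons v₁ v₂, σ => .cons (v₁.subst σ) (v₂.subst σ)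
  | .nil, _ => .nil
  | .tuple vs, σ => .tuple (valsSubst vs σ)
  | .map kvs, σ => .map (valPairsSubst kvs σ)

/-- Applying a substitution to a non-value. -/
def NonVal.subst : NonVal → Subst → NonVal
  | .func xs e, σ => .func xs (e.subst (σ.hide (varNames xs)))
  | .values es, σ => .values (expsSubst es σ)
  | .cons e₁ e₂, σ => .cons (e₁.subst σ) (e₂.subst σ)
  | .tuple es, σ => .tuple (expsSubst es σ)
  | .map kvs, σ => .map (expPairsSubst kvs σ)
  | .call em ef es, σ => .call (em.subst σ) (ef.subst σ) (expsSubst es σ)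
  | .primop a es, σ => .primop a (expsSubst es σ)
  | .app e es, σ => .app (e.subst σ) (expsSubst es σ)
  | .case e cls, σ => .case (e.subst σ) (clausesSubst cls σ)
  | .letIn xs e₁ e₂, σ => .letIn xs (e₁.subst σ) (e₂.subst (σ.hide (varNames xs)))
  | .seq e₁ e₂, σ => .seq (e₁.subst σ) (e₂.subst σ)
  | .letrec ext e, σ =>
      .letrec (extSubst ext (σ.hide (namesOf ext))) (e.subst (σ.hide (namesOf ext)))
  | .tryCatch e₁ xs e₂ ys e₃, σ =>
      .tryCatch (e₁.subst σ) xs (e₂.subst (σ.hide (varNames xs)))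
        ys (e₃.subst (σ.hide (varNames ys)))

/-- Applying a substitution to a list of expressions. -/
def expsSubst : List Exp → Subst → List Exp
  | [], _ => []
  | e :: es, σ => e.subst σ :: expsSubst es σ

/-- Applying a substitution to a list of pairs of expressions. -/
def expPairsSubst : List (Exp × Exp) → Subst → List (Exp × Exp)
  | [], _ => []
  | (k, e) :: kvs, σ => (k.subst σ, e.subst σ) :: expPairsSubst kvs σ

/-- Applying a substitution to a list of values. -/
def valsSubst : List Val → Subst → List Val
  | [], _ => []
  | v :: vs, σ => v.subst σ :: valsSubst vs σ

/-- Applying a substitution to a list of pairs of values. -/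
def valPairsSubst : List (Val × Val) → Subst → List (Val × Val)
  | [], _ => []
  | (k, v) :: kvs, σ => (k.subst σ, v.subst σ) :: valPairsSubst kvs σ

/-- Applying a substitution, which already leaves the names bound by the whole collection
alone, to function definitions. -/
def extSubst : List ClosItem → Subst → List ClosItem
  | [], _ => []
  | .mk f xs e :: ext, σ => .mk f xs (e.subst (σ.hide (varNames xs))) :: extSubst ext σ

/-- Applying a substitution to clauses. -/
def clausesSubst : List Clause → Subst → List Clause
  | [], _ => []
  | .mk ps eg eb :: cls, σ =>
      .mk ps (eg.subst (σ.hide (varNames (patsVars ps))))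
        (eb.subst (σ.hide (varNames (patsVars ps)))) :: clausesSubst cls σ

end

/-- Applying a substitution to an exception. -/
def Exc.subst (x : Exc) (σ : Subst) : Exc :=
  ⟨x.cls, x.reason.subst σ, x.details.subst σ⟩

/-- Applying a substitution to a redex. -/
def Redex.subst : Redex → Subst → Redex
  | .vals vs, σ => .vals (valsSubst vs σ)
  | .exc x, σ => .exc (x.subst σ)
  | .exp e, σ => .exp (e.subst σ)
  | .box, _ => .box

/-- `σ.Scoped Γ Δ`: the substitution `σ` maps the names in `Γ` to values scoped in `Δ`. -/
def Subst.Scoped (σ : Subst) (Γ Δ : Set Name) : Prop := ∀ x ∈ Γ, (σ x).Scoped Δ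

/-- The bindings of the function identifiers of `ext` to their closures, where each closure
carries all of `ext`. -/
def mkClosList (ext : List ClosItem) : List (Name × Val) :=
  ext.map fun
    | .mk f xs e => (.fid f xs.length, .clos ext xs e)

/-! ## Pattern matching -/

mutual

/-- The bindings of a successful match of a value against a pattern, `none` if the match
fails. Maps are matched pairwise. -/
def Pat.matchVal : Pat → Val → Option (List (Name × Val))
  | .int i, .int j => if i = j then some [] else none
  | .atom a, .atom b => if a = b then some [] else none
  | .var x, v => some [(.var x, v)]
  | .cons p₁ p₂, .cons v₁ v₂ =>
      (p₁.matchVal v₁).bind fun θ₁ => (p₂.matchVal v₂).map fun θ₂ => θ₁ ++ θ₂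
  | .nil, .nil => some []
  | .tuple ps, .tuple vs => matchVals ps vs
  | .map ps, .map kvs => matchPairs ps kvs
  | _, _ => none

/-- Pairwise matching of a value sequence against a list of patterns of the same length. -/
def matchVals : List Pat → List Val → Option (List (Name × Val))
  | [], [] => some []
  | p :: ps, v :: vs =>
      (p.matchVal v).bind fun θ₁ => (matchVals ps vs).map fun θ₂ => θ₁ ++ θ₂
  | _, _ => none

/-- Pairwise matching of key-value pairs. -/
def matchPairs : List (Pat × Pat) → List (Val × Val) → Option (List (Name × Val))
  | [], [] => some []
  | (p, q) :: ps, (k, v) :: kvs =>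
      (p.matchVal k).bind fun θ₁ => (q.matchVal v).bind fun θ₂ =>
        (matchPairs ps kvs).map fun θ₃ => θ₁ ++ (θ₂ ++ θ₃)
  | _, _ => none

end

/-! ## The term order -/

/-- The position of a kind of value in the Erlang term order. (Names are not closed values;
they come last.) -/
def Val.rank : Val → ℕ
  | .int _ => 0
  | .atom _ => 1
  | .clos _ _ _ => 2
  | .tuple _ => 3
  | .map _ => 4
  | .nil => 5
  | .cons _ _ => 6
  | .var _ => 7
  | .fid _ _ => 8

mutual

/-- Comparison of values in the Erlang term order
`number < atom < fun < tuple < map < [] < nonempty list`. Tuples are compared by size, then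
elementwise; maps by size, then by keys, then by associated values. Closures of the same
number of parameters are not distinguished. -/
def Val.cmp : Val → Val → Ordering
  | .int i, .int j => compare i j
  | .atom a, .atom b => compare a b
  | .var x, .var y => compare x y
  | .fid f k, .fid g l => (compare f g).then (compare k l)
  | .clos _ xs _, .clos _ ys _ => compare xs.length ys.length
  | .cons v₁ v₂, .cons w₁ w₂ => (v₁.cmp w₁).then (v₂.cmp w₂)
  | .nil, .nil => .eq
  | .tuple vs, .tuple ws => (compare vs.length ws.length).then (valsCmp vs ws)
  | .map kvs, .map lws =>
      (compare kvs.length lws.length).then ((keysCmp kvs lws).then (itemsCmp kvs lws))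
  | v, w => compare v.rank w.rank

/-- Lexicographic comparison of lists of values. -/
def valsCmp : List Val → List Val → Ordering
  | [], [] => .eq
  | [], _ :: _ => .lt
  | _ :: _, [] => .gt
  | v :: vs, w :: ws => (v.cmp w).then (valsCmp vs ws)

/-- Lexicographic comparison of the keys. -/
def keysCmp : List (Val × Val) → List (Val × Val) → Ordering
  | [], [] => .eq
  | [], _ :: _ => .lt
  | _ :: _, [] => .gt
  | (k, _) :: kvs, (l, _) :: lws => (k.cmp l).then (keysCmp kvs lws)

/-- Lexicographic comparison of the associated values. -/
def itemsCmp : List (Val × Val) → List (Val × Val) → Ordering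
  | [], [] => .eq
  | [], _ :: _ => .lt
  | _ :: _, [] => .gt
  | (_, v) :: kvs, (_, w) :: lws => (v.cmp w).then (itemsCmp kvs lws)

end

/-- Equality of values in the sense of the term order. -/
def Val.same (v w : Val) : Bool := v.cmp w == .eq

/-! ## Maps and lists -/

/-- Insertion of a key with its associated value into an ordered map; it replaces the value
associated with the same key. -/
def mapInsert (k v : Val) : List (Val × Val) → List (Val × Val)
  | [] => [(k, v)]
  | (l, w) :: kvs =>
      match k.cmp l with
      | .lt => (k, v) :: (l, w) :: kvs
      | .eq => (k, v) :: kvs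
      | .gt => (l, w) :: mapInsert k v kvs

/-- The map of a list of key-value pairs, ordered by the keys and without duplicate keys; of
several pairs with the same key, the last one counts. -/
def makeMap (kvs : List (Val × Val)) : List (Val × Val) :=
  kvs.foldl (fun m kv => mapInsert kv.1 kv.2 m) []

/-- Splits `k₁, v₁, …, kₙ, vₙ` into pairs; `none` for a list of odd length. -/
def pairUp : List Val → Option (List (Val × Val))
  | [] => some []
  | [_] => none
  | k :: v :: vs => (pairUp vs).map fun kvs => (k, v) :: kvs

/-- `e₁ᵏ, e₁ᵛ, …, eₙᵏ, eₙᵛ` for the list of the pairs `(eᵢᵏ, eᵢᵛ)`. -/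
def flatten : List (Exp × Exp) → List Exp
  | [] => []
  | (k, e) :: kvs => k :: e :: flatten kvs

/-- The Erlang list of a list of values. -/
def Val.ofList : List Val → Val
  | [] => .nil
  | v :: vs => .cons v (Val.ofList vs)

/-- The elements of a proper Erlang list. -/
def Val.toList : Val → Option (List Val)
  | .nil => some []
  | .cons v w => w.toList.map fun vs => v :: vs
  | _ => none

/-! ## Atoms with a meaning -/

/-- The atom `true`. -/
def aTrue : Atom := mkAtom [116, 114, 117, 101]

/-- The atom `false`. -/
def aFalse : Atom := mkAtom [102, 97, 108, 115, 101]

/-- The atom `throw`. -/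
def aThrow : Atom := mkAtom [116, 104, 114, 111, 119]

/-- The atom `exit`. -/
def aExit : Atom := mkAtom [101, 120, 105, 116]

/-- The atom `error`. -/
def aError : Atom := mkAtom [101, 114, 114, 111, 114]

/-- The atom `if_clause`. -/
def aIfClause : Atom := mkAtom [105, 102, 95, 99, 108, 97, 117, 115, 101]

/-- The atom `badarith`. -/
def aBadarith : Atom := mkAtom [98, 97, 100, 97, 114, 105, 116, 104]

/-- The atom `badarg`. -/
def aBadarg : Atom := mkAtom [98, 97, 100, 97, 114, 103]

/-- The atom `badfun`. -/
def aBadfun : Atom := mkAtom [98, 97, 100, 102, 117, 110]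

/-- The atom `badarity`. -/
def aBadarity : Atom := mkAtom [98, 97, 100, 97, 114, 105, 116, 121]

/-- The atom `undef`. -/
def aUndef : Atom := mkAtom [117, 110, 100, 101, 102]

/-- The atom `match_fail`. -/
def aMatchFail : Atom := mkAtom [109, 97, 116, 99, 104, 95, 102, 97, 105, 108]

/-- The atom `arity`. -/
def aArity : Atom := mkAtom [97, 114, 105, 116, 121]

/-- The atom `erlang`. -/
def aErlang : Atom := mkAtom [101, 114, 108, 97, 110, 103]

/-- The atom `lists`. -/
def aLists : Atom := mkAtom [108, 105, 115, 116, 115]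

/-- A truth value as an atom. -/
def Val.ofBool (b : Bool) : Val := .atom (if b then aTrue else aFalse)

/-- The truth value that an atom denotes. -/
def Val.toBool : Val → Option Bool
  | .atom a => if a = aTrue then some true else if a = aFalse then some false else none
  | _ => none

/-- An exception class as an atom. -/
def ExcClass.toVal : ExcClass → Val
  | .throw => .atom aThrow
  | .exit => .atom aExit
  | .error => .atom aError

/-- An exception of class `error`. -/
def errorExc (reason details : Val) : Redex := .exc ⟨.error, reason, details⟩

/-! ## Built-in functions -/

/-- The built-in functions. -/
inductive Bif where
  | plus | minus | mult | uplus | uminus | div | rem | bsl | bsr | abs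
  | and | or | xor | not
  | eq | ne | lt | le | gt | ge
  | append | subtract | split | length | hd | tl
  | tupleToList | listToTuple | tupleSize | element | setElement | mapSize
  | isNumber | isInteger | isAtom | isBoolean | isList | isTuple | isMap
  | isFunction | isFunctionArity | funInfo
  | throw | exit | error | errorArgs

/-- The built-in functions with their module, name and arity. -/
def bifTable : List ((Atom × Atom × ℕ) × Bif) := [
  ((aErlang, mkAtom [43], 2), .plus), -- plus, arity 2
  ((aErlang, mkAtom [45], 2), .minus), -- minus, arity 2
  ((aErlang, mkAtom [42], 2), .mult), -- times, arity 2
  ((aErlang, mkAtom [43], 1), .uplus), -- plus, arity 1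
  ((aErlang, mkAtom [45], 1), .uminus), -- minus, arity 1
  ((aErlang, mkAtom [100, 105, 118], 2), .div), -- div, arity 2
  ((aErlang, mkAtom [114, 101, 109], 2), .rem), -- rem, arity 2
  ((aErlang, mkAtom [98, 115, 108], 2), .bsl), -- bsl, arity 2
  ((aErlang, mkAtom [98, 115, 114], 2), .bsr), -- bsr, arity 2
  ((aErlang, mkAtom [97, 98, 115], 1), .abs), -- abs, arity 1
  ((aErlang, mkAtom [97, 110, 100], 2), .and), -- and, arity 2
  ((aErlang, mkAtom [111, 114], 2), .or), -- or, arity 2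
  ((aErlang, mkAtom [120, 111, 114], 2), .xor), -- xor, arity 2
  ((aErlang, mkAtom [110, 111, 116], 1), .not), -- not, arity 1
  ((aErlang, mkAtom [61, 61], 2), .eq), -- ==, arity 2
  ((aErlang, mkAtom [61, 58, 61], 2), .eq), -- =:=, arity 2
  ((aErlang, mkAtom [47, 61], 2), .ne), -- slash equals, arity 2
  ((aErlang, mkAtom [61, 47, 61], 2), .ne), -- equals slash equals, arity 2
  ((aErlang, mkAtom [60], 2), .lt), -- <, arity 2
  ((aErlang, mkAtom [61, 60], 2), .le), -- =<, arity 2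
  ((aErlang, mkAtom [62], 2), .gt), -- >, arity 2
  ((aErlang, mkAtom [62, 61], 2), .ge), -- >=, arity 2
  ((aErlang, mkAtom [43, 43], 2), .append), -- plus plus, arity 2
  ((aErlang, mkAtom [45, 45], 2), .subtract), -- minus minus, arity 2
  ((aLists, mkAtom [115, 112, 108, 105, 116], 2), .split), -- split, arity 2
  ((aErlang, mkAtom [108, 101, 110, 103, 116, 104], 1), .length), -- length, arity 1
  ((aErlang, mkAtom [104, 100], 1), .hd), -- hd, arity 1
  ((aErlang, mkAtom [116, 108], 1), .tl), -- tl, arity 1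
  ((aErlang, mkAtom [116, 117, 112, 108, 101, 95, 116, 111, 95, 108, 105, 115, 116], 1), .tupleToList), -- tuple_to_list, arity 1
  ((aErlang, mkAtom [108, 105, 115, 116, 95, 116, 111, 95, 116, 117, 112, 108, 101], 1), .listToTuple), -- list_to_tuple, arity 1
  ((aErlang, mkAtom [116, 117, 112, 108, 101, 95, 115, 105, 122, 101], 1), .tupleSize), -- tuple_size, arity 1
  ((aErlang, mkAtom [101, 108, 101, 109, 101, 110, 116], 2), .element), -- element, arity 2
  ((aErlang, mkAtom [115, 101, 116, 101, 108, 101, 109, 101, 110, 116], 3), .setElement), -- setelement, arity 3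
  ((aErlang, mkAtom [109, 97, 112, 95, 115, 105, 122, 101], 1), .mapSize), -- map_size, arity 1
  ((aErlang, mkAtom [105, 115, 95, 110, 117, 109, 98, 101, 114], 1), .isNumber), -- is_number, arity 1
  ((aErlang, mkAtom [105, 115, 95, 105, 110, 116, 101, 103, 101, 114], 1), .isInteger), -- is_integer, arity 1
  ((aErlang, mkAtom [105, 115, 95, 97, 116, 111, 109], 1), .isAtom), -- is_atom, arity 1
  ((aErlang, mkAtom [105, 115, 95, 98, 111, 111, 108, 101, 97, 110], 1), .isBoolean), -- is_boolean, arity 1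
  ((aErlang, mkAtom [105, 115, 95, 108, 105, 115, 116], 1), .isList), -- is_list, arity 1
  ((aErlang, mkAtom [105, 115, 95, 116, 117, 112, 108, 101], 1), .isTuple), -- is_tuple, arity 1
  ((aErlang, mkAtom [105, 115, 95, 109, 97, 112], 1), .isMap), -- is_map, arity 1
  ((aErlang, mkAtom [105, 115, 95, 102, 117, 110, 99, 116, 105, 111, 110], 1), .isFunction), -- is_function, arity 1
  ((aErlang, mkAtom [105, 115, 95, 102, 117, 110, 99, 116, 105, 111, 110], 2), .isFunctionArity), -- is_function, arity 2
  ((aErlang, mkAtom [102, 117, 110, 95, 105, 110, 102, 111], 2), .funInfo), -- fun_info, arity 2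
  ((aErlang, mkAtom [116, 104, 114, 111, 119], 1), .throw), -- throw, arity 1
  ((aErlang, mkAtom [101, 120, 105, 116], 1), .exit), -- exit, arity 1
  ((aErlang, mkAtom [101, 114, 114, 111, 114], 1), .error), -- error, arity 1
  ((aErlang, mkAtom [101, 114, 114, 111, 114], 2), .errorArgs) -- error, arity 2
  ]

/-- Shift by `k` bits to the left (to the right if `k` is negative). -/
def shiftLeft (i k : ℤ) : ℤ :=
  if 0 ≤ k then i * 2 ^ k.toNat else i / 2 ^ (-k).toNat

/-- The value of a built-in function, `none` if the arguments are illegal. -/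
def Bif.value : Bif → List Val → Option Val
  | .plus, [.int i, .int j] => some (.int (i + j))
  | .minus, [.int i, .int j] => some (.int (i - j))
  | .mult, [.int i, .int j] => some (.int (i * j))
  | .uplus, [.int i] => some (.int i)
  | .uminus, [.int i] => some (.int (-i))
  | .div, [.int i, .int j] => if j = 0 then none else some (.int (i.tdiv j))
  | .rem, [.int i, .int j] => if j = 0 then none else some (.int (i.tmod j))
  | .bsl, [.int i, .int j] => some (.int (shiftLeft i j))
  | .bsr, [.int i, .int j] => some (.int (shiftLeft i (-j)))
  | .abs, [.int i] => some (.int |i|)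
  | .and, [v, w] => v.toBool.bind fun b => w.toBool.map fun c => Val.ofBool (b && c)
  | .or, [v, w] => v.toBool.bind fun b => w.toBool.map fun c => Val.ofBool (b || c)
  | .xor, [v, w] => v.toBool.bind fun b => w.toBool.map fun c => Val.ofBool (b ^^ c)
  | .not, [v] => v.toBool.map fun b => Val.ofBool (!b)
  | .eq, [v, w] => some (Val.ofBool (v.same w))
  | .ne, [v, w] => some (Val.ofBool (!v.same w))
  | .lt, [v, w] => some (Val.ofBool (v.cmp w).isLT)
  | .le, [v, w] => some (Val.ofBool (v.cmp w).isLE)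
  | .gt, [v, w] => some (Val.ofBool (v.cmp w).isGT)
  | .ge, [v, w] => some (Val.ofBool (v.cmp w).isGE)
  | .append, [v, w] => v.toList.map fun vs => vs.foldr Val.cons w
  | .subtract, [v, w] => v.toList.bind fun vs => w.toList.map fun ws =>
      Val.ofList (ws.foldl (fun us w => us.eraseP fun u => u.same w) vs)
  | .split, [.int i, v] => v.toList.bind fun vs =>
      if 0 ≤ i ∧ i ≤ vs.length then
        some (.tuple [Val.ofList (vs.take i.toNat), Val.ofList (vs.drop i.toNat)])
      else none
  | .length, [v] => v.toList.map fun vs => .int vs.length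
  | .hd, [.cons v _] => some v
  | .tl, [.cons _ w] => some w
  | .tupleToList, [.tuple vs] => some (Val.ofList vs)
  | .listToTuple, [v] => v.toList.map Val.tuple
  | .tupleSize, [.tuple vs] => some (.int vs.length)
  | .element, [.int i, .tuple vs] => if 1 ≤ i then vs[i.toNat - 1]? else none
  | .setElement, [.int i, .tuple vs, v] =>
      if 1 ≤ i ∧ i ≤ vs.length then some (.tuple (vs.set (i.toNat - 1) v)) else none
  | .mapSize, [.map kvs] => some (.int kvs.length)
  | .isNumber, [v] => some (Val.ofBool (match v with | .int _ => true | _ => false))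
  | .isInteger, [v] => some (Val.ofBool (match v with | .int _ => true | _ => false))
  | .isAtom, [v] => some (Val.ofBool (match v with | .atom _ => true | _ => false))
  | .isBoolean, [v] => some (Val.ofBool v.toBool.isSome)
  | .isList, [v] =>
      some (Val.ofBool (match v with | .nil => true | .cons _ _ => true | _ => false))
  | .isTuple, [v] => some (Val.ofBool (match v with | .tuple _ => true | _ => false))
  | .isMap, [v] => some (Val.ofBool (match v with | .map _ => true | _ => false))
  | .isFunction, [v] => some (Val.ofBool (match v with | .clos _ _ _ => true | _ => false))
  | .isFunctionArity, [v, .int i] =>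
      if 0 ≤ i then
        some (Val.ofBool (match v with | .clos _ xs _ => decide (i = xs.length) | _ => false))
      else none
  | .funInfo, [.clos _ xs _, .atom a] =>
      if a = aArity then some (.tuple [.atom aArity, .int xs.length]) else none
  | _, _ => none

/-- The reason of the exception for illegal arguments. -/
def Bif.badReason : Bif → Atom
  | .plus | .minus | .mult | .uplus | .uminus | .div | .rem | .bsl | .bsr => aBadarith
  | _ => aBadarg

/-- The result of a call of the function `f` of the module `m`. A call of an unknown function
and a call with illegal arguments give an exception. -/
def evalCall (m f : Atom) (vs : List Val) : Redex :=
  match bifTable.lookup (m, f, vs.length), vs with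
  | some .throw, [v] => .exc ⟨.throw, v, .tuple []⟩
  | some .exit, [v] => .exc ⟨.exit, v, .tuple []⟩
  | some .error, [v] => errorExc v (.tuple [])
  | some .errorArgs, [v, w] => errorExc v w
  | some b, vs =>
      match b.value vs with
      | some v => .vals [v]
      | none => errorExc (.atom b.badReason) (.tuple (.atom f :: vs))
  | none, vs => errorExc (.atom aUndef) (.tuple [.atom m, .atom f, Val.ofList vs])

/-- The result of the primitive operation `a`: `match_fail` raises an error with the given
reason, and there are no other primitive operations. -/
def evalPrimop (a : Atom) (vs : List Val) : Redex :=
  match vs with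
  | [v] =>
      if a = aMatchFail then errorExc v (.tuple [])
      else errorExc (.atom aUndef) (.tuple [.atom a, Val.ofList [v]])
  | vs => errorExc (.atom aUndef) (.tuple [.atom a, Val.ofList vs])

/-- The result of applying the value `vf` to parameters. -/
def evalApp (vf : Val) (vs : List Val) : Redex :=
  match vf with
  | .clos ext xs e =>
      if xs.length = vs.length then
        .exp (e.subst (Subst.ofList (mkClosList ext ++ bindVars xs vs)))
      else
        errorExc (.tuple [.atom aBadarity, .tuple [.clos ext xs e, Val.ofList vs]]) (.tuple [])
  | vf => errorExc (.tuple [.atom aBadfun, vf]) (.tuple [])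

/-- The redex for a frame identifier and a completely evaluated parameter list; undefined
(`none`) only for a map with an odd number of parameters. -/
def FrameId.eval : FrameId → List Val → Option Redex
  | .tuple, vs => some (.vals [.tuple vs])
  | .values, vs => some (.vals vs)
  | .map, vs => (pairUp vs).map fun kvs => .vals [.map (makeMap kvs)]
  | .call (.atom m) (.atom f), vs => some (evalCall m f vs)
  | .call vm vf, vs => some (errorExc (.atom aBadarg) (.tuple [vm, vf, Val.ofList vs]))
  | .primop a, vs => some (evalPrimop a vs)
  | .app vf, vs => some (evalApp vf vs)

/-! ## Frame stack semantics -/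

/-- The frame is an exception handler. -/
def Frame.IsTry : Frame → Prop
  | .tryCatch _ _ _ _ => True
  | _ => False

/-- `Step K r K' r'` is the reduction step `⟨K, r⟩ ⟶ ⟨K', r'⟩`. -/
inductive Step : FrameStack → Redex → FrameStack → Redex → Prop where
  -- extracting the first redex of an expression
  | sConsTail K e₁ e₂ :
      Step K (.exp (.nonval (.cons e₁ e₂))) (.consTail e₁ :: K) (.exp e₂)
  | sLet K xs e₁ e₂ :
      Step K (.exp (.nonval (.letIn xs e₁ e₂))) (.letIn xs e₂ :: K) (.exp e₁)
  | sSeq K e₁ e₂ :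
      Step K (.exp (.nonval (.seq e₁ e₂))) (.seq e₂ :: K) (.exp e₁)
  | sApp K e es :
      Step K (.exp (.nonval (.app e es))) (.app es :: K) (.exp e)
  | sCallMod K em ef es :
      Step K (.exp (.nonval (.call em ef es))) (.callMod ef es :: K) (.exp em)
  | sPrimOp K a es :
      Step K (.exp (.nonval (.primop a es))) (.params (.primop a) [] es :: K) .box
  | sVals K es :
      Step K (.exp (.nonval (.values es))) (.params .values [] es :: K) .box
  | sTuple K es :
      Step K (.exp (.nonval (.tuple es))) (.params .tuple [] es :: K) .box
  | sMap K k e kvs :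
      Step K (.exp (.nonval (.map ((k, e) :: kvs))))
        (.params .map [] (e :: flatten kvs) :: K) (.exp k)
  | sCase K e cls :
      Step K (.exp (.nonval (.case e cls))) (.case cls :: K) (.exp e)
  | sTry K e₁ xs e₂ ys e₃ :
      Step K (.exp (.nonval (.tryCatch e₁ xs e₂ ys e₃))) (.tryCatch xs e₂ ys e₃ :: K) (.exp e₁)
  -- modifying the top frame
  | sConsHead K e₁ v₂ :
      Step (.consTail e₁ :: K) (.vals [v₂]) (.consHead v₂ :: K) (.exp e₁)
  | sCallFun K ef es vm :
      Step (.callMod ef es :: K) (.vals [vm]) (.callFun vm es :: K) (.exp ef)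
  | sCallParam K vm es vf :
      Step (.callFun vm es :: K) (.vals [vf]) (.params (.call vm vf) [] es :: K) .box
  | sAppParam K es v :
      Step (.app es :: K) (.vals [v]) (.params (.app v) [] es :: K) .box
  | sCaseFail K ps eg eb cls vs (h : matchVals ps vs = none) :
      Step (.case (.mk ps eg eb :: cls) :: K) (.vals vs) (.case cls :: K) (.vals vs)
  | sCaseSuccess K ps eg eb cls vs θ (h : matchVals ps vs = some θ) :
      Step (.case (.mk ps eg eb :: cls) :: K) (.vals vs)
        (.caseGuard vs ps (eb.subst (Subst.ofList θ)) cls :: K)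
        (.exp (eg.subst (Subst.ofList θ)))
  | sCaseFalse K vs ps eb cls :
      Step (.caseGuard vs ps eb cls :: K) (.vals [.atom aFalse]) (.case cls :: K) (.vals vs)
  | sParams₀ K id e es (h : id ≠ .map) :
      Step (.params id [] (e :: es) :: K) .box (.params id [] es :: K) (.exp e)
  | sParams K id vs v e es :
      Step (.params id vs (e :: es) :: K) (.vals [v]) (.params id (vs ++ [v]) es :: K) (.exp e)
  -- removing the top frame, and reductions that leave the stack alone
  | pMap₀ K :
      Step K (.exp (.nonval (.map []))) K (.vals [.map []])
  | pFun K xs e :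
      Step K (.exp (.nonval (.func xs e))) K (.vals [.clos [] xs e])
  | pLetRec K ext e :
      Step K (.exp (.nonval (.letrec ext e))) K (.exp (e.subst (Subst.ofList (mkClosList ext))))
  | pValue K v :
      Step K (.exp (.val v)) K (.vals [v])
  | pParams₀ K id vs r (hid : id ≠ .map) (h : id.eval vs = some r) :
      Step (.params id vs [] :: K) .box K r
  | pParams K id vs v r (h : id.eval (vs ++ [v]) = some r) :
      Step (.params id vs [] :: K) (.vals [v]) K r
  | pCons K v₁ v₂ :
      Step (.consHead v₂ :: K) (.vals [v₁]) K (.vals [.cons v₁ v₂])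
  | pCaseTrue K vs ps eb cls :
      Step (.caseGuard vs ps eb cls :: K) (.vals [.atom aTrue]) K (.exp eb)
  | pLet K xs e₂ vs (h : xs.length = vs.length) :
      Step (.letIn xs e₂ :: K) (.vals vs) K (.exp (e₂.subst (Subst.ofList (bindVars xs vs))))
  | pSeq K e₂ v :
      Step (.seq e₂ :: K) (.vals [v]) K (.exp e₂)
  | pTry K xs e₂ ys e₃ vs (h : xs.length = vs.length) :
      Step (.tryCatch xs e₂ ys e₃ :: K) (.vals vs) K
        (.exp (e₂.subst (Subst.ofList (bindVars xs vs))))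
  -- creating, handling and propagating exceptions
  | excCase K vs :
      Step (.case [] :: K) (.vals vs) K (errorExc (.atom aIfClause) (.tuple []))
  | excTry K xs e₂ y₁ y₂ y₃ e₃ (x : Exc) :
      Step (.tryCatch xs e₂ [y₁, y₂, y₃] e₃ :: K) (.exc x) K
        (.exp (e₃.subst
          (Subst.ofList (bindVars [y₁, y₂, y₃] [x.cls.toVal, x.reason, x.details]))))
  | excProp K (F : Frame) x (h : ¬ F.IsTry) :
      Step (F :: K) (.exc x) K (.exc x)

/-- `StepN n K r K' r'`: `n` reduction steps lead from `⟨K, r⟩` to `⟨K', r'⟩`. -/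
inductive StepN : ℕ → FrameStack → Redex → FrameStack → Redex → Prop where
  | refl K r : StepN 0 K r K r
  | head {n K r K' r' K'' r''} (h : Step K r K' r') (t : StepN n K' r' K'' r'') :
      StepN (n + 1) K r K'' r''

/-- `⟨K, r⟩ ⇓ⁿ`: termination in exactly `n` steps. -/
def TermN (K : FrameStack) (r : Redex) (n : ℕ) : Prop :=
  ∃ res : Redex, res.IsResult ∧ StepN n K r [] res

/-- `⟨K, r⟩ ⇓`: termination. -/
def Term (K : FrameStack) (r : Redex) : Prop := ∃ n, TermN K r n

/-! ## Logical relations for closed syntax -/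

mutual

/-- `VRel n v₁ v₂`: the closed values `v₁`, `v₂` are related at the step index `n`. Closures are
related if they have the same number of parameters and their bodies are related after
substituting their recursive definitions and related actual parameters; the names of the
parameters do not matter, as terms are considered up to renaming of bound names. -/
def VRel (n : ℕ) (v₁ v₂ : Val) : Prop :=
  v₁.Scoped ∅ ∧ v₂.Scoped ∅ ∧
  match v₁, v₂ with
  | .int i, .int j => i = j
  | .atom a, .atom b => a = b
  | .nil, .nil => True
  | .cons v w, .cons v' w' => VRel n v v' ∧ VRel n w w'
  | .tuple vs, .tuple vs' => VsRel n vs vs'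
  | .map kvs, .map kvs' => KVsRel n kvs kvs'
  | .clos ext xs e, .clos ext' xs' e' =>
      xs.length = xs'.length ∧
      ∀ m, m < n → ∀ vs vs' : List Val,
        vs.length = xs.length → vs'.length = xs'.length → VsRel m vs vs' →
          ERel m (e.subst (Subst.ofList (mkClosList ext ++ bindVars xs vs)))
            (e'.subst (Subst.ofList (mkClosList ext' ++ bindVars xs' vs')))
  | _, _ => False
termination_by (4 * n, sizeOf v₁)

/-- Elementwise related lists of values of the same length. -/
def VsRel (n : ℕ) (vs ws : List Val) : Prop :=
  match vs, ws with
  | [], [] => True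
  | v :: vs, w :: ws => VRel n v w ∧ VsRel n vs ws
  | _, _ => False
termination_by (4 * n, sizeOf vs)

/-- Elementwise related lists of key-value pairs of the same length. -/
def KVsRel (n : ℕ) (kvs lws : List (Val × Val)) : Prop :=
  match kvs, lws with
  | [], [] => True
  | (k, v) :: kvs, (l, w) :: lws => VRel n k l ∧ VRel n v w ∧ KVsRel n kvs lws
  | _, _ => False
termination_by (4 * n, sizeOf kvs)

/-- `XRel n x₁ x₂`: the exceptions `x₁`, `x₂` are related at the step index `n`. -/
def XRel (n : ℕ) (x₁ x₂ : Exc) : Prop :=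
  x₁.cls = x₂.cls ∧ VRel n x₁.reason x₂.reason ∧ VRel n x₁.details x₂.details
termination_by (4 * n + 1, 0)

/-- `KRel n K₁ K₂`: the closed frame stacks `K₁`, `K₂` are related at the step index `n`. -/
def KRel (n : ℕ) (K₁ K₂ : FrameStack) : Prop :=
  StackClosed K₁ ∧ StackClosed K₂ ∧
  (∀ m, m ≤ n → ∀ vs₁ vs₂ : List Val, VsRel m vs₁ vs₂ →
    TermN K₁ (.vals vs₁) m → Term K₂ (.vals vs₂)) ∧
  (∀ m, m ≤ n → ∀ x₁ x₂ : Exc, XRel m x₁ x₂ →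
    TermN K₁ (.exc x₁) m → Term K₂ (.exc x₂)) ∧
  (∀ m, m ≤ n → TermN K₁ .box m → Term K₂ .box)
termination_by (4 * n + 2, 0)

/-- `ERel n e₁ e₂`: the closed expressions `e₁`, `e₂` are related at the step index `n`. -/
def ERel (n : ℕ) (e₁ e₂ : Exp) : Prop :=
  e₁.Scoped ∅ ∧ e₂.Scoped ∅ ∧
  ∀ m, m ≤ n → ∀ K₁ K₂ : FrameStack, KRel m K₁ K₂ →
    TermN K₁ (.exp e₁) m → Term K₂ (.exp e₂)
termination_by (4 * n + 3, 0)

end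

/-- `RRel n r₁ r₂`: the closed redexes `r₁`, `r₂` are related at the step index `n`. -/
def RRel (n : ℕ) (r₁ r₂ : Redex) : Prop :=
  r₁.Scoped ∅ ∧ r₂.Scoped ∅ ∧
  ∀ m, m ≤ n → ∀ K₁ K₂ : FrameStack, KRel m K₁ K₂ → TermN K₁ r₁ m → Term K₂ r₂

/-! ## Logical relations for open syntax -/

/-- `GRel Γ n σ₁ σ₂`: the substitutions `σ₁`, `σ₂`, which map the names in `Γ` to closed values,
are related at the step index `n`. -/
def GRel (Γ : Set Name) (n : ℕ) (σ₁ σ₂ : Subst) : Prop :=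
  σ₁.Scoped Γ ∅ ∧ σ₂.Scoped Γ ∅ ∧ ∀ x ∈ Γ, VRel n (σ₁ x) (σ₂ x)

/-- The logical relation for open values. -/
def VRelOpen (Γ : Set Name) (v₁ v₂ : Val) : Prop :=
  ∀ n σ₁ σ₂, GRel Γ n σ₁ σ₂ → VRel n (v₁.subst σ₁) (v₂.subst σ₂)

/-- The logical relation for open expressions. -/
def ERelOpen (Γ : Set Name) (e₁ e₂ : Exp) : Prop :=
  ∀ n σ₁ σ₂, GRel Γ n σ₁ σ₂ → ERel n (e₁.subst σ₁) (e₂.subst σ₂)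

/-- The logical relation for open exceptions. -/
def XRelOpen (Γ : Set Name) (x₁ x₂ : Exc) : Prop :=
  ∀ n σ₁ σ₂, GRel Γ n σ₁ σ₂ → XRel n (x₁.subst σ₁) (x₂.subst σ₂)

/-- The logical relation for open redexes. -/
def RRelOpen (Γ : Set Name) (r₁ r₂ : Redex) : Prop :=
  ∀ n σ₁ σ₂, GRel Γ n σ₁ σ₂ → RRel n (r₁.subst σ₁) (r₂.subst σ₂)

end CoreErlang

/-!
The fundamental property is an induction on the syntax: the compatibility lemmas `eRel_*` say that
each construct of the language preserves the relation, and `Exp.Scoped.eRelOpen`,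
`Val.Scoped.vRelOpen` and `NonVal.Scoped.eRelOpen` put them together.

A compatibility lemma compares the first steps of the two sides (`ERel.of_step`). Such a step
usually pushes a frame, so that the work is in the lemmas `kRel_*`: related frames on top of
related stacks give related stacks. For a frame other than a `try` frame only value sequences and
the hole have to be examined (`KRel.cons`). Each step of the left-hand side uses up one unit of the
step index, which is what an application needs: closures related at the index `n` have bodies
related at the indices below `n` only (`evalApp_rel`).

The semantics inspects values in three places, and none of them tells related values apart:
pattern matching yields related bindings (`matchVals_rel`), the term order compares related values
in the same way since it sees only the number of parameters of a closure (`VRel.cmp_eq`), and hence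
the built-in functions yield related results (`Bif.value_rel`).

Under binders, the body of a construct is first closed by a substitution that leaves the bound
names alone, and the bound names are instantiated later. As only closed values are substituted,
the two substitutions compose to one on the extended scope (`Exp.subst_subst`), where the induction
hypothesis applies (`ERelOpen.bodyRel`). Closures carry their recursive definitions, and the
bindings created by unfolding a closure are such closures again; they are related by a separate
induction on the step index (`vRel_clos_self`).

A substitution by closed values is related to itself because a closed value is not changed by
substitution, so that the property for values applies to it.
-/

namespace CoreErlang

/-! ### Scopes and substitutions -/

theorem mem_extend {Γ : Set Name} {ns : List Name} {x : Name} :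
    x ∈ extend Γ ns ↔ x ∈ Γ ∨ x ∈ ns := Iff.rfl

theorem extend_mono {Γ Δ : Set Name} (h : Γ ⊆ Δ) (ns : List Name) : extend Γ ns ⊆ extend Δ ns :=
  Set.union_subset_union_left _ h

theorem extend_extend (Γ : Set Name) (ns ms : List Name) :
    extend (extend Γ ns) ms = extend Γ (ns ++ ms) := by
  ext x
  simp [mem_extend, or_assoc]

theorem Subst.hide_hide (σ : Subst) (ns ms : List Name) :
    (σ.hide ns).hide ms = σ.hide (ns ++ ms) := by
  funext x
  by_cases h₁ : x ∈ ns <;> by_cases h₂ : x ∈ ms <;> simp [Subst.hide, h₁, h₂]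

theorem Subst.hide_of_mem {σ : Subst} {ns : List Name} {x : Name} (h : x ∈ ns) :
    σ.hide ns x = Val.ofName x := if_pos h

theorem Subst.hide_of_notMem {σ : Subst} {ns : List Name} {x : Name} (h : x ∉ ns) :
    σ.hide ns x = σ x := if_neg h

theorem namesOf_extSubst (ext : List ClosItem) (σ : Subst) :
    namesOf (extSubst ext σ) = namesOf ext := by
  induction ext with
  | nil => simp [extSubst]
  | cons c ext ih =>
    cases c
    simp only [namesOf, extSubst, List.map_cons, ClosItem.name] at ih ⊢
    rw [ih]

mutual

theorem Exp.Scoped.mono {Γ Δ : Set Name} (hs : Γ ⊆ Δ) :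
    ∀ {e : Exp}, e.Scoped Γ → e.Scoped Δ
  | .val _, h => Val.Scoped.mono hs h
  | .nonval _, h => NonVal.Scoped.mono hs h

theorem Val.Scoped.mono {Γ Δ : Set Name} (hs : Γ ⊆ Δ) :
    ∀ {v : Val}, v.Scoped Γ → v.Scoped Δ
  | .int _, _ => trivial
  | .atom _, _ => trivial
  | .var _, h => hs h
  | .fid _ _, h => hs h
  | .clos _ _ _, h =>
    ⟨extScoped_mono (extend_mono hs _) h.1,
      Exp.Scoped.mono (extend_mono (extend_mono hs _) _) h.2⟩
  | .cons _ _, h => ⟨Val.Scoped.mono hs h.1, Val.Scoped.mono hs h.2⟩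
  | .nil, _ => trivial
  | .tuple _, h => valsScoped_mono hs h
  | .map _, h => valPairsScoped_mono hs h

theorem NonVal.Scoped.mono {Γ Δ : Set Name} (hs : Γ ⊆ Δ) :
    ∀ {e : NonVal}, e.Scoped Γ → e.Scoped Δ
  | .func _ _, h => Exp.Scoped.mono (extend_mono hs _) h
  | .values _, h => expsScoped_mono hs h
  | .cons _ _, h => ⟨Exp.Scoped.mono hs h.1, Exp.Scoped.mono hs h.2⟩
  | .tuple _, h => expsScoped_mono hs h
  | .map _, h => expPairsScoped_mono hs h
  | .call _ _ _, h =>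
    ⟨Exp.Scoped.mono hs h.1, Exp.Scoped.mono hs h.2.1, expsScoped_mono hs h.2.2⟩
  | .primop _ _, h => expsScoped_mono hs h
  | .app _ _, h => ⟨Exp.Scoped.mono hs h.1, expsScoped_mono hs h.2⟩
  | .case _ _, h => ⟨Exp.Scoped.mono hs h.1, clausesScoped_mono hs h.2⟩
  | .letIn _ _ _, h => ⟨Exp.Scoped.mono hs h.1, Exp.Scoped.mono (extend_mono hs _) h.2⟩
  | .seq _ _, h => ⟨Exp.Scoped.mono hs h.1, Exp.Scoped.mono hs h.2⟩
  | .letrec _ _, h =>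
    ⟨extScoped_mono (extend_mono hs _) h.1, Exp.Scoped.mono (extend_mono hs _) h.2⟩
  | .tryCatch _ _ _ _ _, h =>
    ⟨Exp.Scoped.mono hs h.1, Exp.Scoped.mono (extend_mono hs _) h.2.1,
      Exp.Scoped.mono (extend_mono hs _) h.2.2⟩

theorem expsScoped_mono {Γ Δ : Set Name} (hs : Γ ⊆ Δ) :
    ∀ {es : List Exp}, expsScoped es Γ → expsScoped es Δ
  | [], _ => trivial
  | _ :: _, h => ⟨Exp.Scoped.mono hs h.1, expsScoped_mono hs h.2⟩

theorem expPairsScoped_mono {Γ Δ : Set Name} (hs : Γ ⊆ Δ) :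
    ∀ {kvs : List (Exp × Exp)}, expPairsScoped kvs Γ → expPairsScoped kvs Δ
  | [], _ => trivial
  | (_, _) :: _, h =>
    ⟨Exp.Scoped.mono hs h.1, Exp.Scoped.mono hs h.2.1, expPairsScoped_mono hs h.2.2⟩

theorem valsScoped_mono {Γ Δ : Set Name} (hs : Γ ⊆ Δ) :
    ∀ {vs : List Val}, valsScoped vs Γ → valsScoped vs Δ
  | [], _ => trivial
  | _ :: _, h => ⟨Val.Scoped.mono hs h.1, valsScoped_mono hs h.2⟩

theorem valPairsScoped_mono {Γ Δ : Set Name} (hs : Γ ⊆ Δ) :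
    ∀ {kvs : List (Val × Val)}, valPairsScoped kvs Γ → valPairsScoped kvs Δ
  | [], _ => trivial
  | (_, _) :: _, h =>
    ⟨Val.Scoped.mono hs h.1, Val.Scoped.mono hs h.2.1, valPairsScoped_mono hs h.2.2⟩

theorem extScoped_mono {Γ Δ : Set Name} (hs : Γ ⊆ Δ) :
    ∀ {ext : List ClosItem}, extScoped ext Γ → extScoped ext Δ
  | [], _ => trivial
  | .mk _ _ _ :: _, h => ⟨Exp.Scoped.mono (extend_mono hs _) h.1, extScoped_mono hs h.2⟩

theorem clausesScoped_mono {Γ Δ : Set Name} (hs : Γ ⊆ Δ) :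
    ∀ {cls : List Clause}, clausesScoped cls Γ → clausesScoped cls Δ
  | [], _ => trivial
  | .mk _ _ _ :: _, h =>
    ⟨Exp.Scoped.mono (extend_mono hs _) h.1, Exp.Scoped.mono (extend_mono hs _) h.2.1,
      clausesScoped_mono hs h.2.2⟩

end

/-- `σ.Closes Γ Δ`: on `Γ` the substitution `σ` either puts in a closed value, or leaves a name
of `Δ` alone. Unlike `Subst.Scoped`, this property passes under binders. -/
def Subst.Closes (σ : Subst) (Γ Δ : Set Name) : Prop :=
  ∀ x ∈ Γ, (σ x).Scoped ∅ ∨ (σ x = Val.ofName x ∧ x ∈ Δ)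

theorem Subst.Closes.hide {σ : Subst} {Γ Δ : Set Name} (h : σ.Closes Γ Δ) (ns : List Name) :
    (σ.hide ns).Closes (extend Γ ns) (extend Δ ns) := by
  intro x hx
  by_cases hn : x ∈ ns
  · exact Or.inr ⟨Subst.hide_of_mem hn, Or.inr hn⟩
  · rw [Subst.hide_of_notMem hn]
    exact (h x (hx.resolve_right hn)).imp_right fun h => ⟨h.1, Or.inl h.2⟩

theorem Subst.Closes.scoped {σ : Subst} {Γ Δ : Set Name} (h : σ.Closes Γ Δ) {x : Name}
    (hx : x ∈ Γ) : (σ x).Scoped Δ := by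
  rcases h x hx with h | ⟨h, hd⟩
  · exact h.mono (Set.empty_subset _)
  · rw [h]
    cases x <;> exact hd

mutual

theorem Exp.Scoped.subst {σ : Subst} {Γ Δ : Set Name} (hσ : σ.Closes Γ Δ) :
    ∀ {e : Exp}, e.Scoped Γ → (e.subst σ).Scoped Δ
  | .val _, h => Val.Scoped.subst hσ h
  | .nonval _, h => NonVal.Scoped.subst hσ h

theorem Val.Scoped.subst {σ : Subst} {Γ Δ : Set Name} (hσ : σ.Closes Γ Δ) :
    ∀ {v : Val}, v.Scoped Γ → (v.subst σ).Scoped Δ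
  | .int _, _ => trivial
  | .atom _, _ => trivial
  | .var _, h => hσ.scoped h
  | .fid _ _, h => hσ.scoped h
  | .clos ext xs e, h => by
    simp only [Val.subst, Val.Scoped, namesOf_extSubst]
    exact ⟨extScoped_subst (hσ.hide _) h.1, Exp.Scoped.subst ((hσ.hide _).hide _) h.2⟩
  | .cons _ _, h => ⟨Val.Scoped.subst hσ h.1, Val.Scoped.subst hσ h.2⟩
  | .nil, _ => trivial
  | .tuple _, h => valsScoped_subst hσ h
  | .map _, h => valPairsScoped_subst hσ h

theorem NonVal.Scoped.subst {σ : Subst} {Γ Δ : Set Name} (hσ : σ.Closes Γ Δ) :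
    ∀ {e : NonVal}, e.Scoped Γ → (e.subst σ).Scoped Δ
  | .func _ _, h => Exp.Scoped.subst (hσ.hide _) h
  | .values _, h => expsScoped_subst hσ h
  | .cons _ _, h => ⟨Exp.Scoped.subst hσ h.1, Exp.Scoped.subst hσ h.2⟩
  | .tuple _, h => expsScoped_subst hσ h
  | .map _, h => expPairsScoped_subst hσ h
  | .call _ _ _, h =>
    ⟨Exp.Scoped.subst hσ h.1, Exp.Scoped.subst hσ h.2.1, expsScoped_subst hσ h.2.2⟩
  | .primop _ _, h => expsScoped_subst hσ h
  | .app _ _, h => ⟨Exp.Scoped.subst hσ h.1, expsScoped_subst hσ h.2⟩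
  | .case _ _, h => ⟨Exp.Scoped.subst hσ h.1, clausesScoped_subst hσ h.2⟩
  | .letIn _ _ _, h => ⟨Exp.Scoped.subst hσ h.1, Exp.Scoped.subst (hσ.hide _) h.2⟩
  | .seq _ _, h => ⟨Exp.Scoped.subst hσ h.1, Exp.Scoped.subst hσ h.2⟩
  | .letrec _ _, h => by
    simp only [NonVal.subst, NonVal.Scoped, namesOf_extSubst]
    exact ⟨extScoped_subst (hσ.hide _) h.1, Exp.Scoped.subst (hσ.hide _) h.2⟩
  | .tryCatch _ _ _ _ _, h =>
    ⟨Exp.Scoped.subst hσ h.1, Exp.Scoped.subst (hσ.hide _) h.2.1,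
      Exp.Scoped.subst (hσ.hide _) h.2.2⟩

theorem expsScoped_subst {σ : Subst} {Γ Δ : Set Name} (hσ : σ.Closes Γ Δ) :
    ∀ {es : List Exp}, expsScoped es Γ → expsScoped (expsSubst es σ) Δ
  | [], _ => trivial
  | _ :: _, h => ⟨Exp.Scoped.subst hσ h.1, expsScoped_subst hσ h.2⟩

theorem expPairsScoped_subst {σ : Subst} {Γ Δ : Set Name} (hσ : σ.Closes Γ Δ) :
    ∀ {kvs : List (Exp × Exp)}, expPairsScoped kvs Γ → expPairsScoped (expPairsSubst kvs σ) Δ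
  | [], _ => trivial
  | (_, _) :: _, h =>
    ⟨Exp.Scoped.subst hσ h.1, Exp.Scoped.subst hσ h.2.1, expPairsScoped_subst hσ h.2.2⟩

theorem valsScoped_subst {σ : Subst} {Γ Δ : Set Name} (hσ : σ.Closes Γ Δ) :
    ∀ {vs : List Val}, valsScoped vs Γ → valsScoped (valsSubst vs σ) Δ
  | [], _ => trivial
  | _ :: _, h => ⟨Val.Scoped.subst hσ h.1, valsScoped_subst hσ h.2⟩

theorem valPairsScoped_subst {σ : Subst} {Γ Δ : Set Name} (hσ : σ.Closes Γ Δ) :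
    ∀ {kvs : List (Val × Val)}, valPairsScoped kvs Γ → valPairsScoped (valPairsSubst kvs σ) Δ
  | [], _ => trivial
  | (_, _) :: _, h =>
    ⟨Val.Scoped.subst hσ h.1, Val.Scoped.subst hσ h.2.1, valPairsScoped_subst hσ h.2.2⟩

theorem extScoped_subst {σ : Subst} {Γ Δ : Set Name} (hσ : σ.Closes Γ Δ) :
    ∀ {ext : List ClosItem}, extScoped ext Γ → extScoped (extSubst ext σ) Δ
  | [], _ => trivial
  | .mk _ _ _ :: _, h => ⟨Exp.Scoped.subst (hσ.hide _) h.1, extScoped_subst hσ h.2⟩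

theorem clausesScoped_subst {σ : Subst} {Γ Δ : Set Name} (hσ : σ.Closes Γ Δ) :
    ∀ {cls : List Clause}, clausesScoped cls Γ → clausesScoped (clausesSubst cls σ) Δ
  | [], _ => trivial
  | .mk _ _ _ :: _, h =>
    ⟨Exp.Scoped.subst (hσ.hide _) h.1, Exp.Scoped.subst (hσ.hide _) h.2.1,
      clausesScoped_subst hσ h.2.2⟩

end

/-- `σ.Fixes Γ`: the substitution `σ` leaves the names in `Γ` alone. -/
def Subst.Fixes (σ : Subst) (Γ : Set Name) : Prop := ∀ x ∈ Γ, σ x = Val.ofName x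

theorem Subst.Fixes.hide {σ : Subst} {Γ : Set Name} (h : σ.Fixes Γ) (ns : List Name) :
    (σ.hide ns).Fixes (extend Γ ns) := by
  intro x hx
  by_cases hn : x ∈ ns
  · exact Subst.hide_of_mem hn
  · rw [Subst.hide_of_notMem hn]
    exact h x (hx.resolve_right hn)

mutual

theorem Exp.subst_of_fixes {σ : Subst} {Γ : Set Name} (hσ : σ.Fixes Γ) :
    ∀ {e : Exp}, e.Scoped Γ → e.subst σ = e
  | .val _, h => by rw [Exp.subst, Val.subst_of_fixes hσ h]
  | .nonval _, h => by rw [Exp.subst, NonVal.subst_of_fixes hσ h]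

theorem Val.subst_of_fixes {σ : Subst} {Γ : Set Name} (hσ : σ.Fixes Γ) :
    ∀ {v : Val}, v.Scoped Γ → v.subst σ = v
  | .int _, _ => rfl
  | .atom _, _ => rfl
  | .var _, h => hσ _ h
  | .fid _ _, h => hσ _ h
  | .clos _ _ _, h => by
    rw [Val.subst, extSubst_of_fixes (hσ.hide _) h.1,
      Exp.subst_of_fixes ((hσ.hide _).hide _) h.2]
  | .cons _ _, h => by rw [Val.subst, Val.subst_of_fixes hσ h.1, Val.subst_of_fixes hσ h.2]
  | .nil, _ => rfl
  | .tuple _, h => by rw [Val.subst, valsSubst_of_fixes hσ h]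
  | .map _, h => by rw [Val.subst, valPairsSubst_of_fixes hσ h]

theorem NonVal.subst_of_fixes {σ : Subst} {Γ : Set Name} (hσ : σ.Fixes Γ) :
    ∀ {e : NonVal}, e.Scoped Γ → e.subst σ = e
  | .func _ _, h => by rw [NonVal.subst, Exp.subst_of_fixes (hσ.hide _) h]
  | .values _, h => by rw [NonVal.subst, expsSubst_of_fixes hσ h]
  | .cons _ _, h => by
    rw [NonVal.subst, Exp.subst_of_fixes hσ h.1, Exp.subst_of_fixes hσ h.2]
  | .tuple _, h => by rw [NonVal.subst, expsSubst_of_fixes hσ h]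
  | .map _, h => by rw [NonVal.subst, expPairsSubst_of_fixes hσ h]
  | .call _ _ _, h => by
    rw [NonVal.subst, Exp.subst_of_fixes hσ h.1, Exp.subst_of_fixes hσ h.2.1,
      expsSubst_of_fixes hσ h.2.2]
  | .primop _ _, h => by rw [NonVal.subst, expsSubst_of_fixes hσ h]
  | .app _ _, h => by
    rw [NonVal.subst, Exp.subst_of_fixes hσ h.1, expsSubst_of_fixes hσ h.2]
  | .case _ _, h => by
    rw [NonVal.subst, Exp.subst_of_fixes hσ h.1, clausesSubst_of_fixes hσ h.2]
  | .letIn _ _ _, h => by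
    rw [NonVal.subst, Exp.subst_of_fixes hσ h.1, Exp.subst_of_fixes (hσ.hide _) h.2]
  | .seq _ _, h => by
    rw [NonVal.subst, Exp.subst_of_fixes hσ h.1, Exp.subst_of_fixes hσ h.2]
  | .letrec _ _, h => by
    rw [NonVal.subst, extSubst_of_fixes (hσ.hide _) h.1, Exp.subst_of_fixes (hσ.hide _) h.2]
  | .tryCatch _ _ _ _ _, h => by
    rw [NonVal.subst, Exp.subst_of_fixes hσ h.1, Exp.subst_of_fixes (hσ.hide _) h.2.1,
      Exp.subst_of_fixes (hσ.hide _) h.2.2]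

theorem expsSubst_of_fixes {σ : Subst} {Γ : Set Name} (hσ : σ.Fixes Γ) :
    ∀ {es : List Exp}, expsScoped es Γ → expsSubst es σ = es
  | [], _ => rfl
  | _ :: _, h => by rw [expsSubst, Exp.subst_of_fixes hσ h.1, expsSubst_of_fixes hσ h.2]

theorem expPairsSubst_of_fixes {σ : Subst} {Γ : Set Name} (hσ : σ.Fixes Γ) :
    ∀ {kvs : List (Exp × Exp)}, expPairsScoped kvs Γ → expPairsSubst kvs σ = kvs
  | [], _ => rfl
  | (_, _) :: _, h => by
    rw [expPairsSubst, Exp.subst_of_fixes hσ h.1, Exp.subst_of_fixes hσ h.2.1,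
      expPairsSubst_of_fixes hσ h.2.2]

theorem valsSubst_of_fixes {σ : Subst} {Γ : Set Name} (hσ : σ.Fixes Γ) :
    ∀ {vs : List Val}, valsScoped vs Γ → valsSubst vs σ = vs
  | [], _ => rfl
  | _ :: _, h => by rw [valsSubst, Val.subst_of_fixes hσ h.1, valsSubst_of_fixes hσ h.2]

theorem valPairsSubst_of_fixes {σ : Subst} {Γ : Set Name} (hσ : σ.Fixes Γ) :
    ∀ {kvs : List (Val × Val)}, valPairsScoped kvs Γ → valPairsSubst kvs σ = kvs
  | [], _ => rfl
  | (_, _) :: _, h => by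
    rw [valPairsSubst, Val.subst_of_fixes hσ h.1, Val.subst_of_fixes hσ h.2.1,
      valPairsSubst_of_fixes hσ h.2.2]

theorem extSubst_of_fixes {σ : Subst} {Γ : Set Name} (hσ : σ.Fixes Γ) :
    ∀ {ext : List ClosItem}, extScoped ext Γ → extSubst ext σ = ext
  | [], _ => rfl
  | .mk _ _ _ :: _, h => by
    rw [extSubst, Exp.subst_of_fixes (hσ.hide _) h.1, extSubst_of_fixes hσ h.2]

theorem clausesSubst_of_fixes {σ : Subst} {Γ : Set Name} (hσ : σ.Fixes Γ) :
    ∀ {cls : List Clause}, clausesScoped cls Γ → clausesSubst cls σ = cls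
  | [], _ => rfl
  | .mk _ _ _ :: _, h => by
    rw [clausesSubst, Exp.subst_of_fixes (hσ.hide _) h.1, Exp.subst_of_fixes (hσ.hide _) h.2.1,
      clausesSubst_of_fixes hσ h.2.2]

end

theorem Val.subst_of_closed {v : Val} (h : v.Scoped ∅) (σ : Subst) : v.subst σ = v :=
  Val.subst_of_fixes (Γ := ∅) (fun _ hx => hx.elim) h

/-- `Subst.IsComp Γ σ τ ρ`: on `Γ` the substitution `ρ` is `σ` followed by `τ`, where each name
is either left alone by `σ` or mapped by `σ` to a closed value, which `τ` does not change. -/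
def Subst.IsComp (Γ : Set Name) (σ τ ρ : Subst) : Prop :=
  ∀ x ∈ Γ, (σ x = Val.ofName x ∧ ρ x = τ x) ∨ ((σ x).Scoped ∅ ∧ ρ x = σ x)

theorem Subst.IsComp.hide {σ τ ρ : Subst} {Γ : Set Name} (h : Subst.IsComp Γ σ τ ρ)
    (ns : List Name) : Subst.IsComp (extend Γ ns) (σ.hide ns) (τ.hide ns) (ρ.hide ns) := by
  intro x hx
  by_cases hn : x ∈ ns
  · simp only [Subst.hide_of_mem hn]
    exact Or.inl ⟨trivial, trivial⟩
  · simp only [Subst.hide_of_notMem hn]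
    exact h x (hx.resolve_right hn)

theorem Subst.IsComp.apply {σ τ ρ : Subst} {Γ : Set Name} (h : Subst.IsComp Γ σ τ ρ)
    {x : Name} (hx : x ∈ Γ) : (σ x).subst τ = ρ x := by
  rcases h x hx with ⟨h₁, h₂⟩ | ⟨h₁, h₂⟩
  · rw [h₁, h₂]
    cases x <;> rfl
  · rw [Val.subst_of_closed h₁, h₂]

mutual

/-- Successive substitutions compose. No name is captured, as `σ` puts in closed values only. -/
theorem Exp.subst_subst {σ τ ρ : Subst} {Γ : Set Name} (hc : Subst.IsComp Γ σ τ ρ) :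
    ∀ {e : Exp}, e.Scoped Γ → (e.subst σ).subst τ = e.subst ρ
  | .val _, h => by simp only [Exp.subst, Val.subst_subst hc h]
  | .nonval _, h => by simp only [Exp.subst, NonVal.subst_subst hc h]

theorem Val.subst_subst {σ τ ρ : Subst} {Γ : Set Name} (hc : Subst.IsComp Γ σ τ ρ) :
    ∀ {v : Val}, v.Scoped Γ → (v.subst σ).subst τ = v.subst ρ
  | .int _, _ => rfl
  | .atom _, _ => rfl
  | .var _, h => hc.apply h
  | .fid _ _, h => hc.apply h
  | .clos _ _ _, h => by
    simp only [Val.subst, namesOf_extSubst, extSubst_extSubst (hc.hide _) h.1,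
      Exp.subst_subst ((hc.hide _).hide _) h.2]
  | .cons _ _, h => by
    simp only [Val.subst, Val.subst_subst hc h.1, Val.subst_subst hc h.2]
  | .nil, _ => rfl
  | .tuple _, h => by simp only [Val.subst, valsSubst_valsSubst hc h]
  | .map _, h => by simp only [Val.subst, valPairsSubst_valPairsSubst hc h]

theorem NonVal.subst_subst {σ τ ρ : Subst} {Γ : Set Name} (hc : Subst.IsComp Γ σ τ ρ) :
    ∀ {e : NonVal}, e.Scoped Γ → (e.subst σ).subst τ = e.subst ρ
  | .func _ _, h => by simp only [NonVal.subst, Exp.subst_subst (hc.hide _) h]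
  | .values _, h => by simp only [NonVal.subst, expsSubst_expsSubst hc h]
  | .cons _ _, h => by
    simp only [NonVal.subst, Exp.subst_subst hc h.1, Exp.subst_subst hc h.2]
  | .tuple _, h => by simp only [NonVal.subst, expsSubst_expsSubst hc h]
  | .map _, h => by simp only [NonVal.subst, expPairsSubst_expPairsSubst hc h]
  | .call _ _ _, h => by
    simp only [NonVal.subst, Exp.subst_subst hc h.1, Exp.subst_subst hc h.2.1,
      expsSubst_expsSubst hc h.2.2]
  | .primop _ _, h => by simp only [NonVal.subst, expsSubst_expsSubst hc h]
  | .app _ _, h => by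
    simp only [NonVal.subst, Exp.subst_subst hc h.1, expsSubst_expsSubst hc h.2]
  | .case _ _, h => by
    simp only [NonVal.subst, Exp.subst_subst hc h.1, clausesSubst_clausesSubst hc h.2]
  | .letIn _ _ _, h => by
    simp only [NonVal.subst, Exp.subst_subst hc h.1, Exp.subst_subst (hc.hide _) h.2]
  | .seq _ _, h => by
    simp only [NonVal.subst, Exp.subst_subst hc h.1, Exp.subst_subst hc h.2]
  | .letrec _ _, h => by
    simp only [NonVal.subst, namesOf_extSubst, extSubst_extSubst (hc.hide _) h.1,
      Exp.subst_subst (hc.hide _) h.2]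
  | .tryCatch _ _ _ _ _, h => by
    simp only [NonVal.subst, Exp.subst_subst hc h.1, Exp.subst_subst (hc.hide _) h.2.1,
      Exp.subst_subst (hc.hide _) h.2.2]

theorem expsSubst_expsSubst {σ τ ρ : Subst} {Γ : Set Name} (hc : Subst.IsComp Γ σ τ ρ) :
    ∀ {es : List Exp}, expsScoped es Γ → expsSubst (expsSubst es σ) τ = expsSubst es ρ
  | [], _ => rfl
  | _ :: _, h => by
    simp only [expsSubst, Exp.subst_subst hc h.1, expsSubst_expsSubst hc h.2]

theorem expPairsSubst_expPairsSubst {σ τ ρ : Subst} {Γ : Set Name}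
    (hc : Subst.IsComp Γ σ τ ρ) : ∀ {kvs : List (Exp × Exp)}, expPairsScoped kvs Γ →
      expPairsSubst (expPairsSubst kvs σ) τ = expPairsSubst kvs ρ
  | [], _ => rfl
  | (_, _) :: _, h => by
    simp only [expPairsSubst, Exp.subst_subst hc h.1, Exp.subst_subst hc h.2.1,
      expPairsSubst_expPairsSubst hc h.2.2]

theorem valsSubst_valsSubst {σ τ ρ : Subst} {Γ : Set Name} (hc : Subst.IsComp Γ σ τ ρ) :
    ∀ {vs : List Val}, valsScoped vs Γ → valsSubst (valsSubst vs σ) τ = valsSubst vs ρ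
  | [], _ => rfl
  | _ :: _, h => by
    simp only [valsSubst, Val.subst_subst hc h.1, valsSubst_valsSubst hc h.2]

theorem valPairsSubst_valPairsSubst {σ τ ρ : Subst} {Γ : Set Name}
    (hc : Subst.IsComp Γ σ τ ρ) : ∀ {kvs : List (Val × Val)}, valPairsScoped kvs Γ →
      valPairsSubst (valPairsSubst kvs σ) τ = valPairsSubst kvs ρ
  | [], _ => rfl
  | (_, _) :: _, h => by
    simp only [valPairsSubst, Val.subst_subst hc h.1, Val.subst_subst hc h.2.1,
      valPairsSubst_valPairsSubst hc h.2.2]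

theorem extSubst_extSubst {σ τ ρ : Subst} {Γ : Set Name} (hc : Subst.IsComp Γ σ τ ρ) :
    ∀ {ext : List ClosItem}, extScoped ext Γ → extSubst (extSubst ext σ) τ = extSubst ext ρ
  | [], _ => rfl
  | .mk _ _ _ :: _, h => by
    simp only [extSubst, Exp.subst_subst (hc.hide _) h.1, extSubst_extSubst hc h.2]

theorem clausesSubst_clausesSubst {σ τ ρ : Subst} {Γ : Set Name}
    (hc : Subst.IsComp Γ σ τ ρ) : ∀ {cls : List Clause}, clausesScoped cls Γ →
      clausesSubst (clausesSubst cls σ) τ = clausesSubst cls ρ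
  | [], _ => rfl
  | .mk _ _ _ :: _, h => by
    simp only [clausesSubst, Exp.subst_subst (hc.hide _) h.1,
      Exp.subst_subst (hc.hide _) h.2.1, clausesSubst_clausesSubst hc h.2.2]

end

/-! ### Related values -/

theorem VRel.scoped_left {n : ℕ} {v w : Val} (h : VRel n v w) : v.Scoped ∅ := by
  unfold VRel at h
  exact h.1

theorem VRel.scoped_right {n : ℕ} {v w : Val} (h : VRel n v w) : w.Scoped ∅ := by
  unfold VRel at h
  exact h.2.1

theorem vsRel_iff {n : ℕ} {vs ws : List Val} : VsRel n vs ws ↔ List.Forall₂ (VRel n) vs ws := by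
  induction vs generalizing ws with
  | nil => cases ws <;> simp [VsRel]
  | cons v vs ih => cases ws <;> simp [VsRel, ih]

/-- Pairs with related first and related second components. -/
def PairRel (n : ℕ) (p q : Val × Val) : Prop := VRel n p.1 q.1 ∧ VRel n p.2 q.2

theorem kvsRel_iff {n : ℕ} {kvs lws : List (Val × Val)} :
    KVsRel n kvs lws ↔ List.Forall₂ (PairRel n) kvs lws := by
  induction kvs generalizing lws with
  | nil => cases lws <;> simp [KVsRel]
  | cons p kvs ih =>
    obtain ⟨k, v⟩ := p
    rcases lws with - | ⟨⟨l, w⟩, lws⟩ <;> simp [KVsRel, ih, PairRel, and_assoc]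

theorem valsScoped_of_rel {n : ℕ} {vs ws : List Val} (h : List.Forall₂ (VRel n) vs ws) :
    valsScoped vs ∅ ∧ valsScoped ws ∅ := by
  induction h with
  | nil => exact ⟨trivial, trivial⟩
  | cons h _ ih => exact ⟨⟨h.scoped_left, ih.1⟩, ⟨h.scoped_right, ih.2⟩⟩

theorem valPairsScoped_of_rel {n : ℕ} {kvs lws : List (Val × Val)}
    (h : List.Forall₂ (PairRel n) kvs lws) :
    valPairsScoped kvs ∅ ∧ valPairsScoped lws ∅ := by
  induction h with
  | nil => exact ⟨trivial, trivial⟩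
  | cons h _ ih =>
    exact ⟨⟨h.1.scoped_left, h.2.scoped_left, ih.1⟩, ⟨h.1.scoped_right, h.2.scoped_right, ih.2⟩⟩

section Inversion

variable {n : ℕ} {u : Val}

theorem vRel_int_left {i : ℤ} : VRel n (.int i) u ↔ u = .int i := by
  cases u <;> simp [VRel, Val.Scoped, eq_comm]

theorem vRel_atom_left {a : Atom} : VRel n (.atom a) u ↔ u = .atom a := by
  cases u <;> simp [VRel, Val.Scoped, eq_comm]

theorem vRel_nil_left : VRel n .nil u ↔ u = .nil := by
  cases u <;> simp [VRel, Val.Scoped]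

theorem vRel_cons {v w v' w' : Val} :
    VRel n (.cons v w) (.cons v' w') ↔ VRel n v v' ∧ VRel n w w' := by
  constructor
  · intro h
    rw [VRel] at h
    exact h.2.2
  · intro h
    rw [VRel]
    exact ⟨⟨h.1.scoped_left, h.2.scoped_left⟩, ⟨h.1.scoped_right, h.2.scoped_right⟩, h⟩

theorem vRel_tuple {vs ws : List Val} :
    VRel n (.tuple vs) (.tuple ws) ↔ List.Forall₂ (VRel n) vs ws := by
  constructor
  · intro h
    rw [VRel] at h
    exact vsRel_iff.1 h.2.2
  · intro h
    rw [VRel]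
    exact ⟨(valsScoped_of_rel h).1, (valsScoped_of_rel h).2, vsRel_iff.2 h⟩

theorem vRel_map {kvs lws : List (Val × Val)} :
    VRel n (.map kvs) (.map lws) ↔ List.Forall₂ (PairRel n) kvs lws := by
  constructor
  · intro h
    rw [VRel] at h
    exact kvsRel_iff.1 h.2.2
  · intro h
    rw [VRel]
    exact ⟨(valPairsScoped_of_rel h).1, (valPairsScoped_of_rel h).2, kvsRel_iff.2 h⟩

theorem vRel_clos {ext ext' : List ClosItem} {xs xs' : List Var} {e e' : Exp} :
    VRel n (.clos ext xs e) (.clos ext' xs' e') ↔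
      (Val.clos ext xs e).Scoped ∅ ∧ (Val.clos ext' xs' e').Scoped ∅ ∧ xs.length = xs'.length ∧
      ∀ m, m < n → ∀ vs vs' : List Val, vs.length = xs.length → vs'.length = xs'.length →
        List.Forall₂ (VRel m) vs vs' →
          ERel m (e.subst (Subst.ofList (mkClosList ext ++ bindVars xs vs)))
            (e'.subst (Subst.ofList (mkClosList ext' ++ bindVars xs' vs'))) := by
  rw [VRel]
  simp only [vsRel_iff]

/-- Case analysis on related values: they are built by the same constructor. -/
@[elab_as_elim]
theorem VRel.cases {motive : Val → Val → Prop} {v w : Val} (h : VRel n v w)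
    (int : ∀ i, motive (.int i) (.int i))
    (atom : ∀ a, motive (.atom a) (.atom a))
    (nil : motive .nil .nil)
    (cons : ∀ v w v' w', VRel n v v' → VRel n w w' → motive (.cons v w) (.cons v' w'))
    (tuple : ∀ vs ws, List.Forall₂ (VRel n) vs ws → motive (.tuple vs) (.tuple ws))
    (map : ∀ kvs lws, List.Forall₂ (PairRel n) kvs lws → motive (.map kvs) (.map lws))
    (clos : ∀ ext xs e ext' xs' e', xs.length = xs'.length →
      VRel n (.clos ext xs e) (.clos ext' xs' e') →
        motive (.clos ext xs e) (.clos ext' xs' e')) :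
    motive v w := by
  cases v with
  | int i => cases vRel_int_left.1 h; exact int i
  | atom a => cases vRel_atom_left.1 h; exact atom a
  | nil => cases vRel_nil_left.1 h; exact nil
  | var x => exact (h.scoped_left : _ ∈ (∅ : Set Name)).elim
  | fid f k => exact (h.scoped_left : _ ∈ (∅ : Set Name)).elim
  | cons v₁ v₂ =>
    cases w with
    | cons w₁ w₂ => exact cons _ _ _ _ (vRel_cons.1 h).1 (vRel_cons.1 h).2
    | _ => simp [VRel] at h
  | tuple vs =>
    cases w with
    | tuple ws => exact tuple _ _ (vRel_tuple.1 h)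
    | _ => simp [VRel] at h
  | map kvs =>
    cases w with
    | map lws => exact map _ _ (vRel_map.1 h)
    | _ => simp [VRel] at h
  | clos ext xs e =>
    cases w with
    | clos ext' xs' e' => exact clos _ _ _ _ _ _ (vRel_clos.1 h).2.2.1 h
    | _ => simp [VRel] at h

theorem vRel_cons_left {v w : Val} :
    VRel n (.cons v w) u ↔ ∃ v' w', u = .cons v' w' ∧ VRel n v v' ∧ VRel n w w' := by
  constructor
  · intro h
    cases u with
    | cons => exact ⟨_, _, rfl, vRel_cons.1 h⟩
    | _ => simp [VRel] at h
  · rintro ⟨_, _, rfl, h⟩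
    exact vRel_cons.2 h

theorem vRel_tuple_left {vs : List Val} :
    VRel n (.tuple vs) u ↔ ∃ ws, u = .tuple ws ∧ List.Forall₂ (VRel n) vs ws := by
  constructor
  · intro h
    cases u with
    | tuple => exact ⟨_, rfl, vRel_tuple.1 h⟩
    | _ => simp [VRel] at h
  · rintro ⟨_, rfl, h⟩
    exact vRel_tuple.2 h

end Inversion

mutual

theorem VRel.mono {m n : ℕ} (hmn : m ≤ n) : ∀ {v w : Val}, VRel n v w → VRel m v w
  | .int _, _, h => vRel_int_left.2 (vRel_int_left.1 h)
  | .atom _, _, h => vRel_atom_left.2 (vRel_atom_left.1 h)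
  | .nil, _, h => vRel_nil_left.2 (vRel_nil_left.1 h)
  | .var _, _, h => (h.scoped_left : _ ∈ (∅ : Set Name)).elim
  | .fid _ _, _, h => (h.scoped_left : _ ∈ (∅ : Set Name)).elim
  | .cons _ _, w, h => by
    obtain ⟨_, _, rfl, h₁, h₂⟩ := vRel_cons_left.1 h
    exact vRel_cons.2 ⟨VRel.mono hmn h₁, VRel.mono hmn h₂⟩
  | .tuple _, w, h => by
    obtain ⟨ws, rfl, hr⟩ := vRel_tuple_left.1 h
    exact vRel_tuple.2 (VsRel.mono hmn hr)
  | .map _, w, h => by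
    cases w with
    | map lws => exact vRel_map.2 (KVsRel.mono hmn (vRel_map.1 h))
    | _ => simp [VRel] at h
  | .clos _ _ _, w, h => by
    cases w with
    | clos =>
      rw [vRel_clos] at h ⊢
      exact ⟨h.1, h.2.1, h.2.2.1, fun k hk => h.2.2.2 k (hk.trans_le hmn)⟩
    | _ => simp [VRel] at h

theorem VsRel.mono {m n : ℕ} (hmn : m ≤ n) : ∀ {vs ws : List Val},
    List.Forall₂ (VRel n) vs ws → List.Forall₂ (VRel m) vs ws
  | [], _, h => by cases h; exact .nil
  | _ :: _, _, h => by
    cases h with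
    | cons h₁ h₂ => exact .cons (VRel.mono hmn h₁) (VsRel.mono hmn h₂)

theorem KVsRel.mono {m n : ℕ} (hmn : m ≤ n) : ∀ {kvs lws : List (Val × Val)},
    List.Forall₂ (PairRel n) kvs lws → List.Forall₂ (PairRel m) kvs lws
  | [], _, h => by cases h; exact .nil
  | (_, _) :: _, _, h => by
    cases h with
    | cons h₁ h₂ =>
      exact .cons ⟨VRel.mono hmn h₁.1, VRel.mono hmn h₁.2⟩ (KVsRel.mono hmn h₂)

end

/-! ### Related substitutions -/

theorem GRel.mono {Γ : Set Name} {m n : ℕ} (hmn : m ≤ n) {σ₁ σ₂ : Subst}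
    (h : GRel Γ n σ₁ σ₂) : GRel Γ m σ₁ σ₂ :=
  ⟨h.1, h.2.1, fun x hx => (h.2.2 x hx).mono hmn⟩

theorem GRel.of_vRel {Γ : Set Name} {n : ℕ} {σ₁ σ₂ : Subst}
    (h : ∀ x ∈ Γ, VRel n (σ₁ x) (σ₂ x)) : GRel Γ n σ₁ σ₂ :=
  ⟨fun x hx => (h x hx).scoped_left, fun x hx => (h x hx).scoped_right, h⟩

theorem Subst.Scoped.closes {σ : Subst} {Γ Δ : Set Name} (h : σ.Scoped Γ ∅) : σ.Closes Γ Δ :=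
  fun x hx => Or.inl (h x hx)

/-- Bindings of the same name to related values. -/
def BindRel (n : ℕ) (p q : Name × Val) : Prop := p.1 = q.1 ∧ VRel n p.2 q.2

theorem BindRel.map_fst_eq {n : ℕ} {θ₁ θ₂ : List (Name × Val)}
    (h : List.Forall₂ (BindRel n) θ₁ θ₂) : θ₁.map Prod.fst = θ₂.map Prod.fst := by
  induction h with
  | nil => rfl
  | cons h _ ih => rw [List.map_cons, List.map_cons, h.1, ih]

/-- Lists of related bindings give related substitutions, also if a name is bound repeatedly: on
both sides its first binding counts. -/
theorem GRel.ofList {n : ℕ} {θ₁ θ₂ : List (Name × Val)}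
    (h : List.Forall₂ (BindRel n) θ₁ θ₂) :
    GRel (extend ∅ (θ₁.map Prod.fst)) n (Subst.ofList θ₁) (Subst.ofList θ₂) := by
  refine GRel.of_vRel fun x hx => ?_
  replace hx := hx.resolve_left fun h => h.elim
  rw [Set.mem_ofPred_eq] at hx
  unfold Subst.ofList
  induction h with
  | nil => simp at hx
  | @cons p q θ₁ θ₂ h _ ih =>
    obtain ⟨y, v⟩ := p
    obtain ⟨z, w⟩ := q
    obtain ⟨rfl, h⟩ := h
    simp only [List.lookup_cons]
    by_cases hxy : x = y
    · simpa [hxy] using h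
    · have : (x == y) = false := by simpa using hxy
      simp only [this]
      exact ih (by simpa [hxy] using hx)

theorem bindVars_rel {n : ℕ} {vs ws : List Val} (h : List.Forall₂ (VRel n) vs ws)
    (xs : List Var) : List.Forall₂ (BindRel n) (bindVars xs vs) (bindVars xs ws) := by
  unfold bindVars
  induction h generalizing xs with
  | nil => simp
  | cons h _ ih =>
    cases xs with
    | nil => simp [varNames]
    | cons x xs => exact .cons ⟨rfl, h⟩ (ih xs)

theorem map_fst_bindVars {xs : List Var} {vs : List Val} (h : xs.length = vs.length) :
    (bindVars xs vs).map Prod.fst = varNames xs :=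
  List.map_fst_zip (by simp [varNames, h])

/-! ### Pattern matching preserves the relation -/

theorem optionRel_map {α α' β β' : Type*} {R : α → β → Prop} {S : α' → β' → Prop} {o : Option α}
    {o' : Option β} {f : α → α'} {g : β → β'} (h : Option.Rel R o o')
    (hfg : ∀ a b, R a b → S (f a) (g b)) : Option.Rel S (o.map f) (o'.map g) := by
  cases h with
  | some h => exact .some (hfg _ _ h)
  | none => exact .none

theorem optionRel_bind {α α' β β' : Type*} {R : α → β → Prop} {S : α' → β' → Prop} {o : Option α}
    {o' : Option β} {f : α → Option α'} {g : β → Option β'} (h : Option.Rel R o o')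
    (hfg : ∀ a b, R a b → Option.Rel S (f a) (g b)) : Option.Rel S (o.bind f) (o'.bind g) := by
  cases h with
  | some h => exact hfg _ _ h
  | none => exact .none

mutual

theorem Pat.matchVal_rel {n : ℕ} : ∀ (p : Pat) {v w : Val}, VRel n v w →
    Option.Rel (List.Forall₂ (BindRel n)) (p.matchVal v) (p.matchVal w)
  | .int i, v, w, h => by
    refine VRel.cases h ?_ ?_ ?_ ?_ ?_ ?_ ?_ <;> intros <;> simp only [Pat.matchVal] <;>
      first | exact .none | skip
    split
    · exact .some .nil
    · exact .none
  | .atom a, v, w, h => by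
    refine VRel.cases h ?_ ?_ ?_ ?_ ?_ ?_ ?_ <;> intros <;> simp only [Pat.matchVal] <;>
      first | exact .none | skip
    split
    · exact .some .nil
    · exact .none
  | .var x, v, w, h => by
    simp only [Pat.matchVal]
    exact .some (.cons ⟨rfl, h⟩ .nil)
  | .cons p q, v, w, h => by
    refine VRel.cases h ?_ ?_ ?_ ?_ ?_ ?_ ?_ <;> intros <;> simp only [Pat.matchVal] <;>
      first | exact .none | skip
    rename_i h₁ h₂
    exact optionRel_bind (Pat.matchVal_rel p h₁) fun _ _ r₁ =>
      optionRel_map (Pat.matchVal_rel q h₂) fun _ _ r₂ => List.rel_append r₁ r₂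
  | .nil, v, w, h => by
    refine VRel.cases h ?_ ?_ ?_ ?_ ?_ ?_ ?_ <;> intros <;> simp only [Pat.matchVal] <;>
      first | exact .none | exact .some .nil
  | .tuple ps, v, w, h => by
    refine VRel.cases h ?_ ?_ ?_ ?_ ?_ ?_ ?_ <;> intros <;> simp only [Pat.matchVal] <;>
      first | exact .none | exact matchVals_rel ps ‹_›
  | .map ps, v, w, h => by
    refine VRel.cases h ?_ ?_ ?_ ?_ ?_ ?_ ?_ <;> intros <;> simp only [Pat.matchVal] <;>
      first | exact .none | exact matchPairs_rel ps ‹_›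

theorem matchVals_rel {n : ℕ} : ∀ (ps : List Pat) {vs ws : List Val},
    List.Forall₂ (VRel n) vs ws →
      Option.Rel (List.Forall₂ (BindRel n)) (matchVals ps vs) (matchVals ps ws)
  | [], _, _, h => by
    cases h <;> simp only [matchVals]
    · exact .some .nil
    · exact .none
  | p :: ps, _, _, h => by
    cases h with
    | nil => exact .none
    | cons h₁ h₂ =>
      exact optionRel_bind (Pat.matchVal_rel p h₁) fun _ _ r₁ =>
        optionRel_map (matchVals_rel ps h₂) fun _ _ r₂ => List.rel_append r₁ r₂

theorem matchPairs_rel {n : ℕ} : ∀ (ps : List (Pat × Pat)) {kvs lws : List (Val × Val)},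
    List.Forall₂ (PairRel n) kvs lws →
      Option.Rel (List.Forall₂ (BindRel n)) (matchPairs ps kvs) (matchPairs ps lws)
  | [], _, _, h => by
    cases h <;> simp only [matchPairs]
    · exact .some .nil
    · exact .none
  | (p, q) :: ps, _, _, h => by
    cases h with
    | nil => exact .none
    | @cons v w _ _ h₁ h₂ =>
      obtain ⟨_, _⟩ := v
      obtain ⟨_, _⟩ := w
      exact optionRel_bind (Pat.matchVal_rel p h₁.1) fun _ _ r₁ =>
        optionRel_bind (Pat.matchVal_rel q h₁.2) fun _ _ r₂ =>
          optionRel_map (matchPairs_rel ps h₂) fun _ _ r₃ =>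
            List.rel_append r₁ (List.rel_append r₂ r₃)

end

theorem varNames_append (xs ys : List Var) : varNames (xs ++ ys) = varNames xs ++ varNames ys :=
  List.map_append

mutual

theorem Pat.map_fst_matchVal : ∀ (p : Pat) {v : Val} {θ : List (Name × Val)},
    p.matchVal v = some θ → θ.map Prod.fst = varNames p.vars
  | .int i, v, θ, h => by
    cases v <;> simp [Pat.matchVal] at h
    simp [← h.2, Pat.vars, varNames]
  | .atom a, v, θ, h => by
    cases v <;> simp [Pat.matchVal] at h
    simp [← h.2, Pat.vars, varNames]
  | .var x, v, θ, h => by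
    simp only [Pat.matchVal, Option.some.injEq] at h
    simp [← h, Pat.vars, varNames]
  | .cons p q, v, θ, h => by
    cases v <;> simp only [Pat.matchVal, reduceCtorEq] at h
    simp only [Option.bind_eq_some_iff, Option.map_eq_some_iff] at h
    obtain ⟨θ₁, h₁, θ₂, h₂, rfl⟩ := h
    rw [List.map_append, Pat.map_fst_matchVal p h₁, Pat.map_fst_matchVal q h₂, Pat.vars,
      varNames_append]
  | .nil, v, θ, h => by
    cases v <;> simp [Pat.matchVal] at h
    simp [h, Pat.vars, varNames]
  | .tuple ps, v, θ, h => by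
    cases v <;> simp only [Pat.matchVal, reduceCtorEq] at h
    exact map_fst_matchVals ps h
  | .map ps, v, θ, h => by
    cases v <;> simp only [Pat.matchVal, reduceCtorEq] at h
    exact map_fst_matchPairs ps h

theorem map_fst_matchVals : ∀ (ps : List Pat) {vs : List Val} {θ : List (Name × Val)},
    matchVals ps vs = some θ → θ.map Prod.fst = varNames (patsVars ps)
  | [], vs, θ, h => by
    cases vs <;> simp [matchVals] at h
    simp [h, patsVars, varNames]
  | p :: ps, vs, θ, h => by
    cases vs <;> simp only [matchVals, reduceCtorEq] at h
    simp only [Option.bind_eq_some_iff, Option.map_eq_some_iff] at h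
    obtain ⟨θ₁, h₁, θ₂, h₂, rfl⟩ := h
    rw [List.map_append, Pat.map_fst_matchVal p h₁, map_fst_matchVals ps h₂, patsVars,
      varNames_append]

theorem map_fst_matchPairs : ∀ (ps : List (Pat × Pat)) {kvs : List (Val × Val)}
    {θ : List (Name × Val)}, matchPairs ps kvs = some θ →
      θ.map Prod.fst = varNames (patPairsVars ps)
  | [], kvs, θ, h => by
    cases kvs <;> simp [matchPairs] at h
    simp [h, patPairsVars, varNames]
  | (p, q) :: ps, kvs, θ, h => by
    cases kvs <;> simp only [matchPairs, reduceCtorEq] at h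
    simp only [Option.bind_eq_some_iff, Option.map_eq_some_iff] at h
    obtain ⟨θ₁, h₁, θ₂, h₂, θ₃, h₃, rfl⟩ := h
    rw [List.map_append, List.map_append, Pat.map_fst_matchVal p h₁, Pat.map_fst_matchVal q h₂,
      map_fst_matchPairs ps h₃, patPairsVars, varNames_append, varNames_append]

end

/-! ### The term order does not distinguish related values -/

mutual

theorem VRel.cmp_eq {n : ℕ} : ∀ {v v' w w' : Val}, VRel n v v' → VRel n w w' →
    v.cmp w = v'.cmp w'
  | .var _, _, _, _, h, _ => (h.scoped_left : _ ∈ (∅ : Set Name)).elim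
  | .fid _ _, _, _, _, h, _ => (h.scoped_left : _ ∈ (∅ : Set Name)).elim
  | .int i, v', w, w', h, h' => by
    cases vRel_int_left.1 h
    refine VRel.cases h' ?_ ?_ ?_ ?_ ?_ ?_ ?_ <;> intros <;> simp [Val.cmp, Val.rank]
  | .atom _, v', w, w', h, h' => by
    cases vRel_atom_left.1 h
    refine VRel.cases h' ?_ ?_ ?_ ?_ ?_ ?_ ?_ <;> intros <;> simp [Val.cmp, Val.rank]
  | .nil, v', w, w', h, h' => by
    cases vRel_nil_left.1 h
    refine VRel.cases h' ?_ ?_ ?_ ?_ ?_ ?_ ?_ <;> intros <;> simp [Val.cmp, Val.rank]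
  | .cons v₁ v₂, v', w, w', h, h' => by
    obtain ⟨_, _, rfl, h₁, h₂⟩ := vRel_cons_left.1 h
    refine VRel.cases h' ?_ ?_ ?_ ?_ ?_ ?_ ?_ <;> intros <;> simp only [Val.cmp, Val.rank]
    rw [VRel.cmp_eq h₁ ‹_›, VRel.cmp_eq h₂ ‹_›]
  | .tuple vs, v', w, w', h, h' => by
    obtain ⟨_, rfl, hr⟩ := vRel_tuple_left.1 h
    refine VRel.cases h' ?_ ?_ ?_ ?_ ?_ ?_ ?_ <;> intros <;> simp only [Val.cmp, Val.rank]
    rename_i h'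
    rw [valsCmp_eq_of_rel hr h', hr.length_eq, h'.length_eq]
  | .map kvs, v', w, w', h, h' => by
    cases v' with
    | map =>
      have h := vRel_map.1 h
      refine VRel.cases h' ?_ ?_ ?_ ?_ ?_ ?_ ?_ <;> intros <;> simp only [Val.cmp, Val.rank]
      rename_i h'
      rw [keysCmp_eq_of_rel h h', itemsCmp_eq_of_rel h h', h.length_eq, h'.length_eq]
    | _ => simp [VRel] at h
  | .clos _ _ _, v', w, w', h, h' => by
    cases v' with
    | clos =>
      have h := (vRel_clos.1 h).2.2.1
      refine VRel.cases h' ?_ ?_ ?_ ?_ ?_ ?_ ?_ <;> intros <;> simp only [Val.cmp, Val.rank]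
      simp only [*]
    | _ => simp [VRel] at h

theorem valsCmp_eq_of_rel {n : ℕ} : ∀ {vs vs' ws ws' : List Val},
    List.Forall₂ (VRel n) vs vs' → List.Forall₂ (VRel n) ws ws' → valsCmp vs ws = valsCmp vs' ws'
  | [], _, _, _, h, h' => by cases h; cases h' <;> simp [valsCmp]
  | _ :: _, _, _, _, h, h' => by
    cases h with
    | cons h₁ h₂ =>
      cases h' with
      | nil => simp [valsCmp]
      | cons h₁' h₂' =>
        simp only [valsCmp]
        rw [VRel.cmp_eq h₁ h₁', valsCmp_eq_of_rel h₂ h₂']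

theorem keysCmp_eq_of_rel {n : ℕ} : ∀ {vs vs' ws ws' : List (Val × Val)},
    List.Forall₂ (PairRel n) vs vs' → List.Forall₂ (PairRel n) ws ws' →
      keysCmp vs ws = keysCmp vs' ws'
  | [], _, _, _, h, h' => by cases h; cases h' <;> simp [keysCmp]
  | (_, _) :: _, _, _, _, h, h' => by
    cases h with
    | @cons _ q _ _ h₁ h₂ =>
      obtain ⟨_, _⟩ := q
      cases h' with
      | nil => simp [keysCmp]
      | @cons p q _ _ h₁' h₂' =>
        obtain ⟨_, _⟩ := p
        obtain ⟨_, _⟩ := q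
        simp only [keysCmp]
        rw [VRel.cmp_eq h₁.1 h₁'.1, keysCmp_eq_of_rel h₂ h₂']

theorem itemsCmp_eq_of_rel {n : ℕ} : ∀ {vs vs' ws ws' : List (Val × Val)},
    List.Forall₂ (PairRel n) vs vs' → List.Forall₂ (PairRel n) ws ws' →
      itemsCmp vs ws = itemsCmp vs' ws'
  | [], _, _, _, h, h' => by cases h; cases h' <;> simp [itemsCmp]
  | (_, _) :: _, _, _, _, h, h' => by
    cases h with
    | @cons _ q _ _ h₁ h₂ =>
      obtain ⟨_, _⟩ := q
      cases h' with
      | nil => simp [itemsCmp]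
      | @cons p q _ _ h₁' h₂' =>
        obtain ⟨_, _⟩ := p
        obtain ⟨_, _⟩ := q
        simp only [itemsCmp]
        rw [VRel.cmp_eq h₁.2 h₁'.2, itemsCmp_eq_of_rel h₂ h₂']

end

/-! ### Built-in functions preserve the relation -/

theorem VRel.same_eq {n : ℕ} {v v' w w' : Val} (h : VRel n v v') (h' : VRel n w w') :
    v.same w = v'.same w' := by
  rw [Val.same, Val.same, VRel.cmp_eq h h']

theorem mapInsert_rel {n : ℕ} {k k' v v' : Val} (hk : VRel n k k') (hv : VRel n v v')
    {kvs lws : List (Val × Val)} (h : List.Forall₂ (PairRel n) kvs lws) :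
    List.Forall₂ (PairRel n) (mapInsert k v kvs) (mapInsert k' v' lws) := by
  induction h with
  | nil => exact .cons (And.intro hk hv) .nil
  | @cons p q _ _ h₁ h₂ ih =>
    obtain ⟨_, _⟩ := p
    obtain ⟨_, _⟩ := q
    simp only [mapInsert]
    rw [← VRel.cmp_eq hk h₁.1]
    dsimp only
    split
    · exact .cons (And.intro hk hv) (.cons h₁ h₂)
    · exact .cons (And.intro hk hv) h₂
    · exact .cons h₁ ih

theorem makeMap_rel {n : ℕ} {kvs lws : List (Val × Val)} (h : List.Forall₂ (PairRel n) kvs lws) :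
    List.Forall₂ (PairRel n) (makeMap kvs) (makeMap lws) := by
  exact List.rel_foldl (P := List.Forall₂ (PairRel n))
    (fun _ _ h _ _ h' => mapInsert_rel h'.1 h'.2 h) .nil h

theorem pairUp_rel {n : ℕ} : ∀ {vs ws : List Val}, List.Forall₂ (VRel n) vs ws →
    Option.Rel (List.Forall₂ (PairRel n)) (pairUp vs) (pairUp ws)
  | [], _, h => by cases h; exact .some .nil
  | [_], _, h => by
    cases h with
    | cons _ h => cases h; exact .none
  | _ :: _ :: vs, _, h => by
    cases h with
    | cons hk h =>
      cases h with
      | @cons _ _ _ ws hv h =>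
        have r := pairUp_rel h
        simp only [pairUp]
        revert r
        generalize pairUp vs = a, pairUp ws = b
        rintro (r | _)
        · exact .some (.cons (And.intro hk hv) r)
        · exact .none

theorem ofList_rel {n : ℕ} {vs ws : List Val} (h : List.Forall₂ (VRel n) vs ws) :
    VRel n (Val.ofList vs) (Val.ofList ws) := by
  induction h with
  | nil => exact vRel_nil_left.2 rfl
  | cons h _ ih => exact vRel_cons.2 ⟨h, ih⟩

theorem toList_rel {n : ℕ} : ∀ {v w : Val}, VRel n v w →
    Option.Rel (List.Forall₂ (VRel n)) v.toList w.toList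
  | .cons v₁ v₂, w, h => by
    obtain ⟨w₁, w₂, rfl, h₁, h₂⟩ := vRel_cons_left.1 h
    exact optionRel_map (toList_rel h₂) fun _ _ h => .cons h₁ h
  | .nil, _, h => by
    rw [vRel_nil_left.1 h]
    exact .some .nil
  | .int _, _, h | .atom _, _, h => by
    first | rw [vRel_int_left.1 h] | rw [vRel_atom_left.1 h]
    exact .none
  | .var _, w, h | .fid _ _, w, h => (h.scoped_left : _ ∈ (∅ : Set Name)).elim
  | .tuple _, w, h | .map _, w, h | .clos _ _ _, w, h => by
    cases w <;> first | exact .none | simp [VRel] at h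

theorem vRel_atom {n : ℕ} (a : Atom) : VRel n (.atom a) (.atom a) := vRel_atom_left.2 rfl

theorem vRel_int {n : ℕ} (i : ℤ) : VRel n (.int i) (.int i) := vRel_int_left.2 rfl

theorem VRel.toBool_eq {n : ℕ} {v w : Val} (h : VRel n v w) : v.toBool = w.toBool := by
  refine VRel.cases h ?_ ?_ ?_ ?_ ?_ ?_ ?_ <;> intros <;> rfl

theorem foldr_cons_rel {n : ℕ} {vs ws : List Val} (h : List.Forall₂ (VRel n) vs ws)
    {v w : Val} (h' : VRel n v w) : VRel n (vs.foldr Val.cons v) (ws.foldr Val.cons w) := by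
  induction h with
  | nil => exact h'
  | cons h _ ih => exact vRel_cons.2 ⟨h, ih⟩

theorem eraseP_rel {n : ℕ} {vs ws : List Val} (h : List.Forall₂ (VRel n) vs ws)
    {v w : Val} (h' : VRel n v w) :
    List.Forall₂ (VRel n) (vs.eraseP fun u => u.same v) (ws.eraseP fun u => u.same w) := by
  induction h with
  | nil => exact .nil
  | cons h h₂ ih =>
    simp only [List.eraseP_cons, VRel.same_eq h h']
    cases Val.same _ w
    · exact .cons h ih
    · exact h₂

theorem subtract_rel {n : ℕ} {vs ws vs' ws' : List Val} (h : List.Forall₂ (VRel n) vs ws)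
    (h' : List.Forall₂ (VRel n) vs' ws') :
    List.Forall₂ (VRel n) (vs'.foldl (fun us w => us.eraseP fun u => u.same w) vs)
      (ws'.foldl (fun us w => us.eraseP fun u => u.same w) ws) := by
  induction h' generalizing vs ws with
  | nil => exact h
  | cons h₁ _ ih => exact ih (eraseP_rel h h₁)

theorem _root_.List.Forall₂.getElem?_rel {α β : Type*} {R : α → β → Prop} {l : List α}
    {m : List β} (h : List.Forall₂ R l m) (i : ℕ) : Option.Rel R l[i]? m[i]? := by
  induction h generalizing i with
  | nil => exact .none
  | cons h _ ih =>
    cases i with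
    | zero => exact .some h
    | succ i => simpa using ih i

theorem _root_.List.Forall₂.set_rel {α β : Type*} {R : α → β → Prop} {l : List α}
    {m : List β} (h : List.Forall₂ R l m) (i : ℕ) {a : α} {b : β} (hab : R a b) :
    List.Forall₂ R (l.set i a) (m.set i b) := by
  induction h generalizing i with
  | nil => exact .nil
  | cons h h' ih =>
    cases i with
    | zero => exact .cons hab h'
    | succ i => exact .cons h (ih i)

theorem vRel_ofBool {n : ℕ} (b : Bool) : VRel n (Val.ofBool b) (Val.ofBool b) := vRel_atom _

theorem Bif.value_rel {n : ℕ} (b : Bif) {vs ws : List Val} (h : List.Forall₂ (VRel n) vs ws) :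
    Option.Rel (VRel n) (b.value vs) (b.value ws) := by
  -- Related arguments agree in their number and in their outermost constructors, so that they are
  -- legal on both sides or on none. Illegal arguments are closed by `.none`.
  cases b
  case throw | exit | error | errorArgs => cases h <;> exact .none
  case plus | minus | mult | uplus | uminus | div | rem | bsl | bsr | abs =>
    rcases h with _ | ⟨h₁, h⟩
    · exact .none
    refine VRel.cases h₁ ?_ ?_ ?_ ?_ ?_ ?_ ?_ <;> intros <;>
      first | exact .none | rcases h with _ | ⟨h₂, h⟩ <;>
      first | exact .none | exact .some (vRel_int _) | skip
    all_goals
      refine VRel.cases h₂ ?_ ?_ ?_ ?_ ?_ ?_ ?_ <;> intros <;>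
        first | exact .none | cases h <;>
        first | exact .none | exact .some (vRel_int _) | simp only [Bif.value]
    all_goals split <;> first | exact .none | exact .some (vRel_int _)
  case and | or | xor =>
    rcases h with _ | ⟨h₁, _ | ⟨h₂, _ | _⟩⟩ <;> first | exact .none | simp only [Bif.value]
    rw [h₁.toBool_eq, h₂.toBool_eq]
    generalize Val.toBool _ = o₁, Val.toBool _ = o₂
    cases o₁ <;> cases o₂ <;> first | exact .none | exact .some (vRel_ofBool _)
  case not =>
    rcases h with _ | ⟨h₁, _ | _⟩ <;> first | exact .none | simp only [Bif.value]
    rw [h₁.toBool_eq]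
    generalize Val.toBool _ = o₁
    cases o₁ <;> first | exact .none | exact .some (vRel_ofBool _)
  case eq | ne | lt | le | gt | ge =>
    rcases h with _ | ⟨h₁, _ | ⟨h₂, _ | _⟩⟩ <;> first | exact .none | simp only [Bif.value]
    simp only [VRel.same_eq h₁ h₂, VRel.cmp_eq h₁ h₂]
    exact .some (vRel_ofBool _)
  case append =>
    rcases h with _ | ⟨h₁, _ | ⟨h₂, _ | _⟩⟩ <;> first | exact .none | simp only [Bif.value]
    exact optionRel_map (toList_rel h₁) fun _ _ h => foldr_cons_rel h h₂
  case subtract =>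
    rcases h with _ | ⟨h₁, _ | ⟨h₂, _ | _⟩⟩ <;> first | exact .none | simp only [Bif.value]
    exact optionRel_bind (toList_rel h₁) fun _ _ h =>
      optionRel_map (toList_rel h₂) fun _ _ h' => ofList_rel (subtract_rel h h')
  case split =>
    rcases h with _ | ⟨h₁, h⟩
    · exact .none
    refine VRel.cases h₁ ?_ ?_ ?_ ?_ ?_ ?_ ?_ <;> intros <;>
      first | exact .none | rcases h with _ | ⟨h₂, _ | _⟩ <;>
      first | exact .none | simp only [Bif.value]
    refine optionRel_bind (toList_rel h₂) fun _ _ h => ?_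
    rw [h.length_eq]
    split
    · exact .some (vRel_tuple.2 (.cons (ofList_rel (List.forall₂_take _ h))
        (.cons (ofList_rel (List.forall₂_drop _ h)) .nil)))
    · exact .none
  case length =>
    rcases h with _ | ⟨h₁, _ | _⟩ <;> first | exact .none | simp only [Bif.value]
    refine optionRel_map (toList_rel h₁) fun _ _ h => ?_
    rw [h.length_eq]
    exact vRel_int _
  case listToTuple =>
    rcases h with _ | ⟨h₁, _ | _⟩ <;> first | exact .none | simp only [Bif.value]
    exact optionRel_map (toList_rel h₁) fun _ _ h => vRel_tuple.2 h
  case hd | tl | tupleToList | tupleSize | mapSize =>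
    rcases h with _ | ⟨h₁, h⟩
    · exact .none
    refine VRel.cases h₁ ?_ ?_ ?_ ?_ ?_ ?_ ?_ <;> intros <;>
      first | exact .none | rcases h with _ | _ <;>
      first | exact .none | simp only [Bif.value]
    first
      | exact .some ‹_›
      | exact .some (ofList_rel ‹_›)
      | rw [List.Forall₂.length_eq ‹_›]; exact .some (vRel_int _)
  case element =>
    rcases h with _ | ⟨h₁, h⟩
    · exact .none
    refine VRel.cases h₁ ?_ ?_ ?_ ?_ ?_ ?_ ?_ <;> intros <;>
      first | exact .none | rcases h with _ | ⟨h₂, h⟩ <;> first | exact .none | skip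
    refine VRel.cases h₂ ?_ ?_ ?_ ?_ ?_ ?_ ?_ <;> intros <;>
      first | exact .none | cases h <;> first | exact .none | simp only [Bif.value]
    split
    · exact List.Forall₂.getElem?_rel ‹_› _
    · exact .none
  case setElement =>
    rcases h with _ | ⟨h₁, h⟩
    · exact .none
    refine VRel.cases h₁ ?_ ?_ ?_ ?_ ?_ ?_ ?_ <;> intros <;>
      first | exact .none | rcases h with _ | ⟨h₂, h⟩ <;> first | exact .none | skip
    refine VRel.cases h₂ ?_ ?_ ?_ ?_ ?_ ?_ ?_ <;> intros <;>
      first | exact .none | rcases h with _ | ⟨h₃, _ | _⟩ <;>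
      first | exact .none | simp only [Bif.value]
    rw [List.Forall₂.length_eq ‹_›]
    split
    · exact .some (vRel_tuple.2 (List.Forall₂.set_rel ‹_› _ h₃))
    · exact .none
  case isBoolean =>
    rcases h with _ | ⟨h₁, _ | _⟩ <;> first | exact .none | simp only [Bif.value]
    rw [h₁.toBool_eq]
    exact .some (vRel_ofBool _)
  case isNumber | isInteger | isAtom | isList | isTuple | isMap | isFunction =>
    rcases h with _ | ⟨h₁, _ | _⟩ <;> first | exact .none | simp only [Bif.value]
    refine VRel.cases h₁ ?_ ?_ ?_ ?_ ?_ ?_ ?_ <;> intros <;> exact .some (vRel_ofBool _)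
  case isFunctionArity =>
    rcases h with _ | ⟨h₁, _ | ⟨h₂, h⟩⟩
    · exact .none
    · exact .none
    refine VRel.cases h₂ ?_ ?_ ?_ ?_ ?_ ?_ ?_ <;> intros <;>
      first | exact .none | cases h <;> first | exact .none | simp only [Bif.value]
    split
    · refine VRel.cases h₁ ?_ ?_ ?_ ?_ ?_ ?_ ?_ <;> intros <;> simp only [*] <;>
        exact .some (vRel_ofBool _)
    · exact .none
  case funInfo =>
    rcases h with _ | ⟨h₁, h⟩
    · exact .none
    refine VRel.cases h₁ ?_ ?_ ?_ ?_ ?_ ?_ ?_ <;> intros <;>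
      first | exact .none | rcases h with _ | ⟨h₂, h⟩ <;> first | exact .none | skip
    refine VRel.cases h₂ ?_ ?_ ?_ ?_ ?_ ?_ ?_ <;> intros <;>
      first | exact .none | cases h <;> first | exact .none | simp only [Bif.value, *]
    split
    · exact .some (vRel_tuple.2 (.cons (vRel_atom _) (.cons (vRel_int _) .nil)))
    · exact .none

/-! ### Related stacks, expressions and redexes -/

theorem xRel_iff {n : ℕ} {x y : Exc} :
    XRel n x y ↔ x.cls = y.cls ∧ VRel n x.reason y.reason ∧ VRel n x.details y.details := by
  rw [XRel]

theorem XRel.mono {m n : ℕ} (hmn : m ≤ n) {x y : Exc} (h : XRel n x y) : XRel m x y := by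
  rw [xRel_iff] at h ⊢
  exact ⟨h.1, h.2.1.mono hmn, h.2.2.mono hmn⟩

theorem XRel.scoped {n : ℕ} {x y : Exc} (h : XRel n x y) : x.Scoped ∅ ∧ y.Scoped ∅ := by
  rw [xRel_iff] at h
  exact ⟨⟨h.2.1.scoped_left, h.2.2.scoped_left⟩, ⟨h.2.1.scoped_right, h.2.2.scoped_right⟩⟩

theorem kRel_iff {n : ℕ} {K₁ K₂ : FrameStack} :
    KRel n K₁ K₂ ↔ StackClosed K₁ ∧ StackClosed K₂ ∧
      (∀ m, m ≤ n → ∀ vs₁ vs₂ : List Val, List.Forall₂ (VRel m) vs₁ vs₂ →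
        TermN K₁ (.vals vs₁) m → Term K₂ (.vals vs₂)) ∧
      (∀ m, m ≤ n → ∀ x₁ x₂ : Exc, XRel m x₁ x₂ →
        TermN K₁ (.exc x₁) m → Term K₂ (.exc x₂)) ∧
      (∀ m, m ≤ n → TermN K₁ .box m → Term K₂ .box) := by
  rw [KRel]
  simp only [vsRel_iff]

theorem KRel.mono {m n : ℕ} (hmn : m ≤ n) {K₁ K₂ : FrameStack} (h : KRel n K₁ K₂) :
    KRel m K₁ K₂ := by
  rw [kRel_iff] at h ⊢
  exact ⟨h.1, h.2.1, fun k hk => h.2.2.1 k (hk.trans hmn),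
    fun k hk => h.2.2.2.1 k (hk.trans hmn), fun k hk => h.2.2.2.2 k (hk.trans hmn)⟩

theorem eRel_iff_rRel {n : ℕ} {e₁ e₂ : Exp} : ERel n e₁ e₂ ↔ RRel n (.exp e₁) (.exp e₂) := by
  rw [ERel]
  rfl

theorem RRel.mono {m n : ℕ} (hmn : m ≤ n) {r₁ r₂ : Redex} (h : RRel n r₁ r₂) : RRel m r₁ r₂ :=
  ⟨h.1, h.2.1, fun k hk => h.2.2 k (hk.trans hmn)⟩

theorem ERel.mono {m n : ℕ} (hmn : m ≤ n) {e₁ e₂ : Exp} (h : ERel n e₁ e₂) : ERel m e₁ e₂ :=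
  eRel_iff_rRel.2 ((eRel_iff_rRel.1 h).mono hmn)

theorem ERel.scoped {n : ℕ} {e₁ e₂ : Exp} (h : ERel n e₁ e₂) : e₁.Scoped ∅ ∧ e₂.Scoped ∅ :=
  ⟨(eRel_iff_rRel.1 h).1, (eRel_iff_rRel.1 h).2.1⟩

theorem rRel_vals {n : ℕ} {vs ws : List Val} (h : List.Forall₂ (VRel n) vs ws) :
    RRel n (.vals vs) (.vals ws) :=
  ⟨(valsScoped_of_rel h).1, (valsScoped_of_rel h).2, fun m hm _ _ hK ht =>
    (kRel_iff.1 hK).2.2.1 m le_rfl _ _ (VsRel.mono hm h) ht⟩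

theorem rRel_exc {n : ℕ} {x y : Exc} (h : XRel n x y) : RRel n (.exc x) (.exc y) :=
  ⟨h.scoped.1, h.scoped.2, fun m hm _ _ hK ht =>
    (kRel_iff.1 hK).2.2.2.1 m le_rfl _ _ (h.mono hm) ht⟩

theorem rRel_box {n : ℕ} : RRel n .box .box :=
  ⟨trivial, trivial, fun m _ _ _ hK ht => (kRel_iff.1 hK).2.2.2.2 m le_rfl ht⟩

theorem Term.of_step {K K' : FrameStack} {r r' : Redex} (h : Step K r K' r') (ht : Term K' r') :
    Term K r := by
  obtain ⟨n, res, hres, ht⟩ := ht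
  exact ⟨n + 1, res, hres, .head h ht⟩

theorem TermN.exists_step_of_cons {F : Frame} {K : FrameStack} {r : Redex} {n : ℕ}
    (h : TermN (F :: K) r n) : ∃ m K' r', n = m + 1 ∧ Step (F :: K) r K' r' ∧ TermN K' r' m := by
  obtain ⟨res, hres, h⟩ := h
  cases h with
  | head h t => exact ⟨_, _, _, rfl, h, res, hres, t⟩

theorem TermN.exists_step_of_exp {K : FrameStack} {e : Exp} {n : ℕ}
    (h : TermN K (.exp e) n) : ∃ m K' r', n = m + 1 ∧ Step K (.exp e) K' r' ∧ TermN K' r' m := by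
  obtain ⟨res, hres, h⟩ := h
  cases h with
  | refl => cases hres
  | head h t => exact ⟨_, _, _, rfl, h, res, hres, t⟩

/-- Related expressions from a simulation of the first step: whenever the first expression
steps in a stack `K₁` and terminates after `m` further steps, the second one terminates in each
stack `K₂` that is related to `K₁` at the index `m`. -/
theorem ERel.of_step {n : ℕ} {e₁ e₂ : Exp} (h₁ : e₁.Scoped ∅) (h₂ : e₂.Scoped ∅)
    (h : ∀ m, m < n → ∀ K₁ K₂ K' r', KRel m K₁ K₂ → Step K₁ (.exp e₁) K' r' →
      TermN K' r' m → Term K₂ (.exp e₂)) : ERel n e₁ e₂ := by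
  refine eRel_iff_rRel.2 ⟨h₁, h₂, fun m hm K₁ K₂ hK ht => ?_⟩
  obtain ⟨k, K', r', rfl, hs, ht⟩ := ht.exists_step_of_exp
  exact h k (by omega) K₁ K₂ K' r' (hK.mono (by omega)) hs ht

/-- Extending related stacks with related frames. Only the reduction of a value sequence and of
the hole has to be simulated: both frames let exceptions pass. -/
theorem KRel.cons {n : ℕ} {F₁ F₂ : Frame} {K₁ K₂ : FrameStack} (hK : KRel n K₁ K₂)
    (hF₁ : F₁.Closed) (hF₂ : F₂.Closed) (ht₁ : ¬ F₁.IsTry) (ht₂ : ¬ F₂.IsTry)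
    (hvals : ∀ m, m < n → ∀ vs₁ vs₂ K' r', List.Forall₂ (VRel (m + 1)) vs₁ vs₂ →
      Step (F₁ :: K₁) (.vals vs₁) K' r' → TermN K' r' m → Term (F₂ :: K₂) (.vals vs₂))
    (hbox : ∀ m, m < n → ∀ K' r', Step (F₁ :: K₁) .box K' r' → TermN K' r' m →
      Term (F₂ :: K₂) .box) : KRel n (F₁ :: K₁) (F₂ :: K₂) := by
  obtain ⟨hc₁, hc₂, -, hexc, -⟩ := kRel_iff.1 hK
  refine kRel_iff.2 ⟨List.forall_mem_cons.2 ⟨hF₁, hc₁⟩, List.forall_mem_cons.2 ⟨hF₂, hc₂⟩,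
    fun m hm vs₁ vs₂ hv ht => ?_, fun m hm x₁ x₂ hx ht => ?_, fun m hm ht => ?_⟩
  · obtain ⟨k, K', r', rfl, hs, ht⟩ := ht.exists_step_of_cons
    exact hvals k hm vs₁ vs₂ K' r' hv hs ht
  · obtain ⟨k, K', r', rfl, hs, ht⟩ := ht.exists_step_of_cons
    cases hs with
    | excTry => exact (ht₁ trivial).elim
    | excProp _ _ _ _ =>
      exact Term.of_step (.excProp _ _ _ ht₂)
        (hexc k (by omega) x₁ x₂ (hx.mono (by omega)) ht)
  · obtain ⟨k, K', r', rfl, hs, ht⟩ := ht.exists_step_of_cons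
    exact hbox k hm K' r' hs ht

/-- Related bodies of a construct that binds the names `ns`: they are related after every
related instantiation of these names. -/
def BodyRel (n : ℕ) (ns : List Name) (e₁ e₂ : Exp) : Prop :=
  e₁.Scoped (extend ∅ ns) ∧ e₂.Scoped (extend ∅ ns) ∧
    ∀ m, m ≤ n → ∀ σ₁ σ₂, GRel (extend ∅ ns) m σ₁ σ₂ → ERel m (e₁.subst σ₁) (e₂.subst σ₂)

theorem BodyRel.mono {m n : ℕ} (hmn : m ≤ n) {ns : List Name} {e₁ e₂ : Exp}
    (h : BodyRel n ns e₁ e₂) : BodyRel m ns e₁ e₂ :=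
  ⟨h.1, h.2.1, fun k hk => h.2.2 k (hk.trans hmn)⟩

theorem BodyRel.subst_ofList {m n : ℕ} (hmn : m ≤ n) {ns : List Name} {e₁ e₂ : Exp}
    (h : BodyRel n ns e₁ e₂) {θ₁ θ₂ : List (Name × Val)}
    (hθ : List.Forall₂ (BindRel m) θ₁ θ₂) (hns : θ₁.map Prod.fst = ns) :
    ERel m (e₁.subst (Subst.ofList θ₁)) (e₂.subst (Subst.ofList θ₂)) := by
  subst hns
  exact h.2.2 m hmn _ _ (GRel.ofList hθ)

theorem BodyRel.subst_bindVars {m n : ℕ} (hmn : m ≤ n) {xs : List Var} {e₁ e₂ : Exp}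
    (h : BodyRel n (varNames xs) e₁ e₂) {vs ws : List Val}
    (hv : List.Forall₂ (VRel m) vs ws) (hl : xs.length = vs.length) :
    ERel m (e₁.subst (Subst.ofList (bindVars xs vs)))
      (e₂.subst (Subst.ofList (bindVars xs ws))) :=
  h.subst_ofList hmn (bindVars_rel hv xs) (map_fst_bindVars hl)

/-! ### Evaluation of complete parameter lists -/

/-- Frame identifiers of the same kind with related values. -/
inductive FrameIdRel (n : ℕ) : FrameId → FrameId → Prop where
  | tuple : FrameIdRel n .tuple .tuple
  | values : FrameIdRel n .values .values
  | map : FrameIdRel n .map .map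
  | call {vm vf vm' vf'} (hm : VRel n vm vm') (hf : VRel n vf vf') :
      FrameIdRel n (.call vm vf) (.call vm' vf')
  | primop (a : Atom) : FrameIdRel n (.primop a) (.primop a)
  | app {vf vf'} (hf : VRel n vf vf') : FrameIdRel n (.app vf) (.app vf')

theorem FrameIdRel.mono {m n : ℕ} (hmn : m ≤ n) {id id' : FrameId} (h : FrameIdRel n id id') :
    FrameIdRel m id id' := by
  cases h with
  | tuple => exact .tuple
  | values => exact .values
  | map => exact .map
  | call hm hf => exact .call (hm.mono hmn) (hf.mono hmn)
  | primop a => exact .primop a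
  | app hf => exact .app (hf.mono hmn)

theorem FrameIdRel.closed {n : ℕ} {id id' : FrameId} (h : FrameIdRel n id id') :
    id.Closed ∧ id'.Closed := by
  cases h with
  | call hm hf =>
    exact ⟨⟨hm.scoped_left, hf.scoped_left⟩, ⟨hm.scoped_right, hf.scoped_right⟩⟩
  | app hf => exact ⟨hf.scoped_left, hf.scoped_right⟩
  | _ => exact ⟨trivial, trivial⟩

theorem rRel_errorExc {n : ℕ} {v v' w w' : Val} (hv : VRel n v v') (hw : VRel n w w') :
    RRel n (errorExc v w) (errorExc v' w') :=
  rRel_exc (xRel_iff.2 ⟨rfl, hv, hw⟩)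

theorem vRel_tuple_nil {n : ℕ} : VRel n (.tuple []) (.tuple []) := vRel_tuple.2 .nil

theorem evalCall_rel {n : ℕ} (m f : Atom) {vs ws : List Val} (h : List.Forall₂ (VRel n) vs ws) :
    RRel n (evalCall m f vs) (evalCall m f ws) := by
  -- the result of all built-in functions but `throw`, `exit` and `error`
  have hgen : ∀ b : Bif, RRel n
      (match b.value vs with
        | some v => .vals [v]
        | none => errorExc (.atom b.badReason) (.tuple (.atom f :: vs)))
      (match b.value ws with
        | some v => .vals [v]
        | none => errorExc (.atom b.badReason) (.tuple (.atom f :: ws))) := by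
    intro b
    have r := b.value_rel h
    revert r
    generalize b.value vs = o, b.value ws = o'
    rintro (h' | _)
    · exact rRel_vals (.cons h' .nil)
    · exact rRel_errorExc (vRel_atom _) (vRel_tuple.2 (.cons (vRel_atom _) h))
  unfold evalCall
  rw [h.length_eq]
  generalize bifTable.lookup _ = o
  cases o with
  | none =>
    exact rRel_errorExc (vRel_atom _) (vRel_tuple.2
      (.cons (vRel_atom _) (.cons (vRel_atom _) (.cons (ofList_rel h) .nil))))
  | some b =>
    have := hgen b
    rcases h with _ | ⟨h₁, _ | ⟨h₂, _ | _⟩⟩ <;> cases b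
    case cons.nil.throw | cons.nil.exit => exact rRel_exc (xRel_iff.2 ⟨rfl, h₁, vRel_tuple_nil⟩)
    case cons.nil.error => exact rRel_errorExc h₁ vRel_tuple_nil
    case cons.cons.nil.errorArgs => exact rRel_errorExc h₁ h₂
    all_goals exact this

theorem evalPrimop_rel {n : ℕ} (a : Atom) {vs ws : List Val} (h : List.Forall₂ (VRel n) vs ws) :
    RRel n (evalPrimop a vs) (evalPrimop a ws) := by
  have hundef : RRel n (errorExc (.atom aUndef) (.tuple [.atom a, Val.ofList vs]))
      (errorExc (.atom aUndef) (.tuple [.atom a, Val.ofList ws])) :=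
    rRel_errorExc (vRel_atom _) (vRel_tuple.2 (.cons (vRel_atom _) (.cons (ofList_rel h) .nil)))
  rcases h with _ | ⟨h₁, _ | _⟩
  · exact hundef
  · simp only [evalPrimop]
    split
    · exact rRel_errorExc h₁ vRel_tuple_nil
    · exact hundef
  · exact hundef

/-- Applying related values at the index `n` gives related redexes at the smaller indices:
related closures have related bodies at these indices only. -/
theorem evalApp_rel {m n : ℕ} (hmn : m < n) {v w : Val} (hv : VRel n v w) {vs ws : List Val}
    (h : List.Forall₂ (VRel n) vs ws) : RRel m (evalApp v vs) (evalApp w ws) := by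
  have hbad : RRel m (errorExc (.tuple [.atom aBadfun, v]) (.tuple []))
      (errorExc (.tuple [.atom aBadfun, w]) (.tuple [])) :=
    rRel_errorExc (vRel_tuple.2 (.cons (vRel_atom _) (.cons (hv.mono hmn.le) .nil)))
      vRel_tuple_nil
  -- a value that is not a closure gives the exception of `hbad`
  revert hbad
  refine VRel.cases hv ?_ ?_ ?_ ?_ ?_ ?_ ?clos
  case clos =>
    intro ext xs e ext' xs' e' hl hc _
    simp only [evalApp]
    by_cases hlen : xs.length = vs.length
    · rw [if_pos hlen, if_pos (by rw [← hl, hlen, h.length_eq])]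
      refine eRel_iff_rRel.1 ((vRel_clos.1 hc).2.2.2 m hmn vs ws hlen.symm ?_
        (VsRel.mono hmn.le h))
      rw [← hl, hlen, h.length_eq]
    · rw [if_neg hlen, if_neg (by rwa [← hl, ← h.length_eq])]
      exact rRel_errorExc (vRel_tuple.2 (.cons (vRel_atom _) (.cons (vRel_tuple.2
        (.cons (hc.mono hmn.le) (.cons (ofList_rel (VsRel.mono hmn.le h)) .nil))) .nil)))
        vRel_tuple_nil
  all_goals
    intros
    assumption

theorem FrameId.eval_rel {m n : ℕ} (hmn : m < n) {id id' : FrameId} (hid : FrameIdRel n id id')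
    {vs ws : List Val} (h : List.Forall₂ (VRel n) vs ws) :
    Option.Rel (RRel m) (id.eval vs) (id'.eval ws) := by
  have h' := VsRel.mono hmn.le h
  cases hid with
  | tuple => exact .some (rRel_vals (.cons (vRel_tuple.2 h') .nil))
  | values => exact .some (rRel_vals h')
  | map =>
    exact optionRel_map (pairUp_rel h') fun _ _ h =>
      rRel_vals (.cons (vRel_map.2 (makeMap_rel h)) .nil)
  | primop a => exact .some (evalPrimop_rel a h')
  | app hf => exact .some (evalApp_rel hmn hf h)
  | @call vm vf vm' vf' hm hf =>
    have hbad : Option.Rel (RRel m)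
        (some (errorExc (.atom aBadarg) (.tuple [vm, vf, Val.ofList vs])))
        (some (errorExc (.atom aBadarg) (.tuple [vm', vf', Val.ofList ws]))) :=
      .some (rRel_errorExc (vRel_atom _) (vRel_tuple.2
        (.cons (hm.mono hmn.le) (.cons (hf.mono hmn.le) (.cons (ofList_rel h') .nil)))))
    -- unless both the module and the function are atoms, the exception of `hbad` is raised
    revert hbad
    refine VRel.cases hm ?_ ?atom ?_ ?_ ?_ ?_ ?_
    case atom =>
      intro a
      refine VRel.cases hf ?_ ?atoms ?_ ?_ ?_ ?_ ?_
      case atoms => exact fun b _ => .some (evalCall_rel a b h')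
      all_goals
        intros
        assumption
    all_goals
      intros
      assumption

/-! ### Related frames extend related stacks -/

theorem RRel.term {n : ℕ} {r₁ r₂ : Redex} (h : RRel n r₁ r₂) {K₁ K₂ : FrameStack}
    (hK : KRel n K₁ K₂) (ht : TermN K₁ r₁ n) : Term K₂ r₂ :=
  h.2.2 n le_rfl K₁ K₂ hK ht

theorem ERel.term {n : ℕ} {e₁ e₂ : Exp} (h : ERel n e₁ e₂) {K₁ K₂ : FrameStack}
    (hK : KRel n K₁ K₂) (ht : TermN K₁ (.exp e₁) n) : Term K₂ (.exp e₂) :=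
  (eRel_iff_rRel.1 h).term hK ht

theorem expsScoped_of_rel {n : ℕ} {es es' : List Exp} (h : List.Forall₂ (ERel n) es es') :
    expsScoped es ∅ ∧ expsScoped es' ∅ := by
  induction h with
  | nil => exact ⟨trivial, trivial⟩
  | cons h _ ih => exact ⟨⟨h.scoped.1, ih.1⟩, ⟨h.scoped.2, ih.2⟩⟩

theorem forall₂_eRel_mono {m n : ℕ} (hmn : m ≤ n) {es es' : List Exp}
    (h : List.Forall₂ (ERel n) es es') : List.Forall₂ (ERel m) es es' :=
  h.imp fun _ _ h => h.mono hmn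

theorem FrameIdRel.ne_map {n : ℕ} {id id' : FrameId} (h : FrameIdRel n id id')
    (hid : id ≠ .map) : id' ≠ .map := by
  cases h <;> simp_all

/-- The induction is on the parameters that are still to be evaluated. The values of the others
are collected in the frame, and finally passed to `FrameId.eval`. -/
theorem kRel_params {n : ℕ} {id id' : FrameId} {vs vs' : List Val} {es es' : List Exp}
    {K₁ K₂ : FrameStack} (hid : FrameIdRel n id id') (hv : List.Forall₂ (VRel n) vs vs')
    (he : List.Forall₂ (ERel n) es es') (hK : KRel n K₁ K₂) :
    KRel n (.params id vs es :: K₁) (.params id' vs' es' :: K₂) := by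
  induction es generalizing n vs vs' es' with
  | nil =>
    cases he
    refine hK.cons ⟨hid.closed.1, (valsScoped_of_rel hv).1, trivial⟩
      ⟨hid.closed.2, (valsScoped_of_rel hv).2, trivial⟩ _root_.id _root_.id ?_ ?_
    · intro m hm _ _ K' r' hw hs ht
      cases hs with
      | pParams _ _ _ v r h =>
        rcases hw with _ | ⟨hw, _ | _⟩
        have r := FrameId.eval_rel (Nat.lt_succ_self m) (hid.mono hm)
          (List.rel_append (VsRel.mono hm hv) (.cons hw .nil))
        rw [h] at r
        generalize h' : FrameId.eval id' _ = o at r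
        cases r with
        | some r => exact Term.of_step (.pParams _ _ _ _ _ h') (r.term (hK.mono hm.le) ht)
    · intro m hm K' r' hs ht
      cases hs with
      | pParams₀ _ _ _ r hne h =>
        have r := FrameId.eval_rel (Nat.lt_succ_self m) (hid.mono hm) (VsRel.mono hm hv)
        rw [h] at r
        generalize h' : FrameId.eval id' _ = o at r
        cases r with
        | some r =>
          exact Term.of_step (.pParams₀ _ _ _ _ (hid.ne_map hne) h') (r.term (hK.mono hm.le) ht)
  | cons e es ih =>
    have hsc := expsScoped_of_rel he
    rcases he with _ | ⟨he, hes⟩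
    refine hK.cons ⟨hid.closed.1, (valsScoped_of_rel hv).1, hsc.1⟩
      ⟨hid.closed.2, (valsScoped_of_rel hv).2, hsc.2⟩ _root_.id _root_.id ?_ ?_
    · intro m hm _ _ K' r' hw hs ht
      cases hs with
      | sParams =>
        rcases hw with _ | ⟨hw, _ | _⟩
        exact Term.of_step (.sParams _ _ _ _ _ _) ((he.mono hm.le).term
          (ih (hid.mono hm.le) (List.rel_append (VsRel.mono hm.le hv)
            (.cons (hw.mono m.le_succ) .nil)) (forall₂_eRel_mono hm.le hes) (hK.mono hm.le)) ht)
    · intro m hm K' r' hs ht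
      cases hs with
      | sParams₀ _ _ _ _ hne =>
        cases hv
        exact Term.of_step (.sParams₀ _ _ _ _ (hid.ne_map hne)) ((he.mono hm.le).term
          (ih (hid.mono hm.le) .nil (forall₂_eRel_mono hm.le hes) (hK.mono hm.le)) ht)

theorem kRel_consHead {n : ℕ} {v v' : Val} {K₁ K₂ : FrameStack} (hv : VRel n v v')
    (hK : KRel n K₁ K₂) : KRel n (.consHead v :: K₁) (.consHead v' :: K₂) := by
  refine hK.cons hv.scoped_left hv.scoped_right id id ?_ (fun _ _ _ _ hs => nomatch hs)
  intro m hm _ _ K' r' hw hs ht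
  cases hs with
  | pCons =>
    rcases hw with _ | ⟨hw, _ | _⟩
    exact Term.of_step (.pCons _ _ _) ((rRel_vals (.cons (vRel_cons.2
      ⟨hw.mono m.le_succ, hv.mono hm.le⟩) .nil)).term (hK.mono hm.le) ht)

theorem kRel_consTail {n : ℕ} {e e' : Exp} {K₁ K₂ : FrameStack} (he : ERel n e e')
    (hK : KRel n K₁ K₂) : KRel n (.consTail e :: K₁) (.consTail e' :: K₂) := by
  refine hK.cons he.scoped.1 he.scoped.2 id id ?_ (fun _ _ _ _ hs => nomatch hs)
  intro m hm _ _ K' r' hw hs ht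
  cases hs with
  | sConsHead =>
    rcases hw with _ | ⟨hw, _ | _⟩
    exact Term.of_step (.sConsHead _ _ _) ((he.mono hm.le).term
      (kRel_consHead (hw.mono m.le_succ) (hK.mono hm.le)) ht)

theorem kRel_callFun {n : ℕ} {v v' : Val} {es es' : List Exp} {K₁ K₂ : FrameStack}
    (hv : VRel n v v') (he : List.Forall₂ (ERel n) es es')
    (hK : KRel n K₁ K₂) : KRel n (.callFun v es :: K₁) (.callFun v' es' :: K₂) := by
  refine hK.cons ⟨hv.scoped_left, (expsScoped_of_rel he).1⟩
    ⟨hv.scoped_right, (expsScoped_of_rel he).2⟩ id id ?_ (fun _ _ _ _ hs => nomatch hs)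
  intro m hm _ _ K' r' hw hs ht
  cases hs with
  | sCallParam =>
    rcases hw with _ | ⟨hw, _ | _⟩
    exact Term.of_step (.sCallParam _ _ _ _) (rRel_box.term
      (kRel_params (.call (hv.mono hm.le) (hw.mono m.le_succ)) .nil
        (forall₂_eRel_mono hm.le he) (hK.mono hm.le)) ht)

theorem kRel_callMod {n : ℕ} {e e' : Exp} {es es' : List Exp} {K₁ K₂ : FrameStack}
    (hf : ERel n e e') (he : List.Forall₂ (ERel n) es es')
    (hK : KRel n K₁ K₂) : KRel n (.callMod e es :: K₁) (.callMod e' es' :: K₂) := by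
  refine hK.cons ⟨hf.scoped.1, (expsScoped_of_rel he).1⟩
    ⟨hf.scoped.2, (expsScoped_of_rel he).2⟩ id id ?_ (fun _ _ _ _ hs => nomatch hs)
  intro m hm _ _ K' r' hw hs ht
  cases hs with
  | sCallFun =>
    rcases hw with _ | ⟨hw, _ | _⟩
    exact Term.of_step (.sCallFun _ _ _ _) ((hf.mono hm.le).term
      (kRel_callFun (hw.mono m.le_succ) (forall₂_eRel_mono hm.le he) (hK.mono hm.le)) ht)

theorem kRel_app {n : ℕ} {es es' : List Exp} {K₁ K₂ : FrameStack}
    (he : List.Forall₂ (ERel n) es es') (hK : KRel n K₁ K₂) :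
    KRel n (.app es :: K₁) (.app es' :: K₂) := by
  refine hK.cons (expsScoped_of_rel he).1 (expsScoped_of_rel he).2 id id ?_
    (fun _ _ _ _ hs => nomatch hs)
  intro m hm _ _ K' r' hw hs ht
  cases hs with
  | sAppParam =>
    rcases hw with _ | ⟨hw, _ | _⟩
    exact Term.of_step (.sAppParam _ _ _) (rRel_box.term
      (kRel_params (.app (hw.mono m.le_succ)) .nil
        (forall₂_eRel_mono hm.le he) (hK.mono hm.le)) ht)

theorem kRel_seq {n : ℕ} {e e' : Exp} {K₁ K₂ : FrameStack} (he : ERel n e e')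
    (hK : KRel n K₁ K₂) : KRel n (.seq e :: K₁) (.seq e' :: K₂) := by
  refine hK.cons he.scoped.1 he.scoped.2 id id ?_ (fun _ _ _ _ hs => nomatch hs)
  intro m hm _ _ K' r' hw hs ht
  cases hs with
  | pSeq =>
    rcases hw with _ | ⟨hw, _ | _⟩
    exact Term.of_step (.pSeq _ _ _) ((he.mono hm.le).term (hK.mono hm.le) ht)

theorem kRel_letIn {n : ℕ} {xs : List Var} {e e' : Exp} {K₁ K₂ : FrameStack}
    (he : BodyRel n (varNames xs) e e') (hK : KRel n K₁ K₂) :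
    KRel n (.letIn xs e :: K₁) (.letIn xs e' :: K₂) := by
  refine hK.cons he.1 he.2.1 id id ?_ (fun _ _ _ _ hs => nomatch hs)
  intro m hm _ _ K' r' hw hs ht
  cases hs with
  | pLet _ _ _ _ hl =>
    exact Term.of_step (.pLet _ _ _ _ (hl.trans hw.length_eq))
      ((he.subst_bindVars hm.le (VsRel.mono m.le_succ hw) hl).term (hK.mono hm.le) ht)

theorem vRel_excClass {n : ℕ} (c : ExcClass) : VRel n c.toVal c.toVal := by
  cases c <;> exact vRel_atom _

theorem kRel_tryCatch {n : ℕ} {xs ys : List Var} {e₂ e₂' e₃ e₃' : Exp} {K₁ K₂ : FrameStack}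
    (he₂ : BodyRel n (varNames xs) e₂ e₂') (he₃ : BodyRel n (varNames ys) e₃ e₃')
    (hK : KRel n K₁ K₂) :
    KRel n (.tryCatch xs e₂ ys e₃ :: K₁) (.tryCatch xs e₂' ys e₃' :: K₂) := by
  have hK' := kRel_iff.1 hK
  refine kRel_iff.2 ⟨List.forall_mem_cons.2 ⟨⟨he₂.1, he₃.1⟩, hK'.1⟩,
    List.forall_mem_cons.2 ⟨⟨he₂.2.1, he₃.2.1⟩, hK'.2.1⟩,
    fun m hm vs₁ vs₂ hw ht => ?_, fun m hm x₁ x₂ hx ht => ?_, fun m hm ht => ?_⟩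
  · obtain ⟨k, K', r', rfl, hs, ht⟩ := ht.exists_step_of_cons
    cases hs with
    | pTry _ _ _ _ _ _ hl =>
      exact Term.of_step (.pTry _ _ _ _ _ _ (hl.trans hw.length_eq))
        ((he₂.subst_bindVars (Nat.le_of_succ_le hm) (VsRel.mono k.le_succ hw) hl).term
          (hK.mono (Nat.le_of_succ_le hm)) ht)
  · obtain ⟨k, K', r', rfl, hs, ht⟩ := ht.exists_step_of_cons
    cases hs with
    | excTry =>
      have hx := xRel_iff.1 (hx.mono k.le_succ)
      refine Term.of_step (.excTry _ _ _ _ _ _ _ _)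
        ((he₃.subst_bindVars (Nat.le_of_succ_le hm) (.cons ?_ (.cons hx.2.1 (.cons hx.2.2 .nil)))
          rfl).term (hK.mono (Nat.le_of_succ_le hm)) ht)
      rw [hx.1]
      exact vRel_excClass _
    | excProp _ _ _ h => exact (h trivial).elim
  · obtain ⟨k, K', r', rfl, hs, ht⟩ := ht.exists_step_of_cons
    cases hs

/-- Clauses with the same patterns whose guards and bodies are related. -/
inductive ClauseRel (n : ℕ) : Clause → Clause → Prop where
  | mk {ps eg eb eg' eb'} (hg : BodyRel n (varNames (patsVars ps)) eg eg')
      (hb : BodyRel n (varNames (patsVars ps)) eb eb') :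
      ClauseRel n (.mk ps eg eb) (.mk ps eg' eb')

theorem ClauseRel.mono {m n : ℕ} (hmn : m ≤ n) {c c' : Clause} (h : ClauseRel n c c') :
    ClauseRel m c c' := by
  cases h with
  | mk hg hb => exact .mk (hg.mono hmn) (hb.mono hmn)

theorem clausesScoped_of_rel {n : ℕ} {cls cls' : List Clause}
    (h : List.Forall₂ (ClauseRel n) cls cls') : clausesScoped cls ∅ ∧ clausesScoped cls' ∅ := by
  induction h with
  | nil => exact ⟨trivial, trivial⟩
  | cons h _ ih =>
    cases h with
    | mk hg hb => exact ⟨⟨hg.1, hb.1, ih.1⟩, ⟨hg.2.1, hb.2.1, ih.2⟩⟩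

theorem kRel_caseGuard {n : ℕ} {vs vs' : List Val} {ps : List Pat} {eb eb' : Exp}
    {cls cls' : List Clause} {K₁ K₂ : FrameStack} (hv : List.Forall₂ (VRel n) vs vs')
    (hb : ERel n eb eb') (hcls : List.Forall₂ (ClauseRel n) cls cls') (hK : KRel n K₁ K₂)
    (hcase : KRel n (.case cls :: K₁) (.case cls' :: K₂)) :
    KRel n (.caseGuard vs ps eb cls :: K₁) (.caseGuard vs' ps eb' cls' :: K₂) := by
  have hsv := valsScoped_of_rel hv
  have hsc := clausesScoped_of_rel hcls
  refine hK.cons ⟨hsv.1, hb.scoped.1, hsc.1⟩ ⟨hsv.2, hb.scoped.2, hsc.2⟩ id id ?_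
    (fun _ _ _ _ hs => nomatch hs)
  intro m hm _ _ K' r' hw hs ht
  cases hs with
  | sCaseFalse =>
    rcases hw with _ | ⟨hw, _ | _⟩
    rw [vRel_atom_left.1 hw]
    exact Term.of_step (.sCaseFalse _ _ _ _ _)
      ((rRel_vals (VsRel.mono hm.le hv)).term (hcase.mono hm.le) ht)
  | pCaseTrue =>
    rcases hw with _ | ⟨hw, _ | _⟩
    rw [vRel_atom_left.1 hw]
    exact Term.of_step (.pCaseTrue _ _ _ _ _) ((hb.mono hm.le).term (hK.mono hm.le) ht)

/-- The induction is on the clauses: if a clause does not match, or if its guard is `'false'`, the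
evaluation goes on with the remaining ones. -/
theorem kRel_case {n : ℕ} {cls cls' : List Clause} {K₁ K₂ : FrameStack}
    (hcls : List.Forall₂ (ClauseRel n) cls cls') (hK : KRel n K₁ K₂) :
    KRel n (.case cls :: K₁) (.case cls' :: K₂) := by
  induction hcls with
  | nil =>
    refine hK.cons trivial trivial id id ?_ (fun _ _ _ _ hs => nomatch hs)
    intro m hm _ _ K' r' hw hs ht
    cases hs with
    | excCase =>
      exact Term.of_step (.excCase _ _)
        ((rRel_errorExc (vRel_atom _) vRel_tuple_nil).term (hK.mono hm.le) ht)
  | @cons c c' cls cls' hc hcls ih =>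
    have hsc := clausesScoped_of_rel (.cons hc hcls)
    refine hK.cons hsc.1 hsc.2 id id ?_ (fun _ _ _ _ hs => nomatch hs)
    intro m hm vs ws K' r' hw hs ht
    cases hc with
    | @mk ps _ _ _ _ hg hb =>
      have hw' := VsRel.mono m.le_succ hw
      cases hs with
      -- the value sequence of the right-hand side matches the same patterns
      | sCaseFail _ _ _ _ _ _ hmatch =>
        have r := matchVals_rel ps hw'
        rw [hmatch] at r
        generalize hmatch' : matchVals ps ws = o at r
        cases r
        exact Term.of_step (.sCaseFail _ _ _ _ _ _ hmatch')
          ((rRel_vals hw').term (ih.mono hm.le) ht)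
      | sCaseSuccess _ _ _ _ _ _ θ hmatch =>
        have r := matchVals_rel ps hw'
        have hns := map_fst_matchVals ps hmatch
        rw [hmatch] at r
        generalize hmatch' : matchVals ps ws = o at r
        cases r with
        | some r =>
          exact Term.of_step (.sCaseSuccess _ _ _ _ _ _ _ hmatch')
            ((hg.subst_ofList hm.le r hns).term
              (kRel_caseGuard hw' (hb.subst_ofList hm.le r hns)
                (hcls.imp fun _ _ h => h.mono hm.le) (hK.mono hm.le) (ih.mono hm.le)) ht)

/-! ### Compatibility of the relation with the constructs of the language -/

theorem eRel_val {n : ℕ} {v w : Val} (h : VRel n v w) : ERel n (.val v) (.val w) := by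
  refine ERel.of_step h.scoped_left h.scoped_right fun m hm K₁ K₂ K' r' hK hs ht => ?_
  cases hs
  exact Term.of_step (.pValue _ _) ((rRel_vals (.cons (h.mono hm.le) .nil)).term hK ht)

theorem eRel_func {n : ℕ} {xs : List Var} {e e' : Exp}
    (h : VRel n (.clos [] xs e) (.clos [] xs e')) :
    ERel n (.nonval (.func xs e)) (.nonval (.func xs e')) := by
  have hs₁ := h.scoped_left.2
  have hs₂ := h.scoped_right.2
  simp only [namesOf, List.map_nil, extend_extend, List.nil_append] at hs₁ hs₂
  refine ERel.of_step hs₁ hs₂ fun m hm K₁ K₂ K' r' hK hs ht => ?_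
  cases hs
  exact Term.of_step (.pFun _ _ _) ((rRel_vals (.cons (h.mono hm.le) .nil)).term hK ht)

theorem eRel_values {n : ℕ} {es es' : List Exp} (h : List.Forall₂ (ERel n) es es') :
    ERel n (.nonval (.values es)) (.nonval (.values es')) := by
  refine ERel.of_step (expsScoped_of_rel h).1 (expsScoped_of_rel h).2
    fun m hm K₁ K₂ K' r' hK hs ht => ?_
  cases hs
  exact Term.of_step (.sVals _ _)
    (rRel_box.term (kRel_params .values .nil (forall₂_eRel_mono hm.le h) hK) ht)

theorem eRel_tuple {n : ℕ} {es es' : List Exp} (h : List.Forall₂ (ERel n) es es') :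
    ERel n (.nonval (.tuple es)) (.nonval (.tuple es')) := by
  refine ERel.of_step (expsScoped_of_rel h).1 (expsScoped_of_rel h).2
    fun m hm K₁ K₂ K' r' hK hs ht => ?_
  cases hs
  exact Term.of_step (.sTuple _ _)
    (rRel_box.term (kRel_params .tuple .nil (forall₂_eRel_mono hm.le h) hK) ht)

theorem eRel_primop {n : ℕ} (a : Atom) {es es' : List Exp} (h : List.Forall₂ (ERel n) es es') :
    ERel n (.nonval (.primop a es)) (.nonval (.primop a es')) := by
  refine ERel.of_step (expsScoped_of_rel h).1 (expsScoped_of_rel h).2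
    fun m hm K₁ K₂ K' r' hK hs ht => ?_
  cases hs
  exact Term.of_step (.sPrimOp _ _ _)
    (rRel_box.term (kRel_params (.primop a) .nil (forall₂_eRel_mono hm.le h) hK) ht)

/-- Pairs of expressions with related first and related second components. -/
def ExpPairRel (n : ℕ) (p q : Exp × Exp) : Prop := ERel n p.1 q.1 ∧ ERel n p.2 q.2

theorem expPairsScoped_of_rel {n : ℕ} {kvs lws : List (Exp × Exp)}
    (h : List.Forall₂ (ExpPairRel n) kvs lws) : expPairsScoped kvs ∅ ∧ expPairsScoped lws ∅ := by
  induction h with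
  | nil => exact ⟨trivial, trivial⟩
  | cons h _ ih =>
    exact ⟨⟨h.1.scoped.1, h.2.scoped.1, ih.1⟩, ⟨h.1.scoped.2, h.2.scoped.2, ih.2⟩⟩

theorem flatten_rel {n : ℕ} {kvs lws : List (Exp × Exp)}
    (h : List.Forall₂ (ExpPairRel n) kvs lws) :
    List.Forall₂ (ERel n) (flatten kvs) (flatten lws) := by
  induction h with
  | nil => exact .nil
  | cons h _ ih => exact .cons h.1 (.cons h.2 ih)

theorem eRel_map {n : ℕ} {kvs lws : List (Exp × Exp)}
    (h : List.Forall₂ (ExpPairRel n) kvs lws) :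
    ERel n (.nonval (.map kvs)) (.nonval (.map lws)) := by
  refine ERel.of_step (expPairsScoped_of_rel h).1 (expPairsScoped_of_rel h).2
    fun m hm K₁ K₂ K' r' hK hs ht => ?_
  cases hs with
  | pMap₀ =>
    cases h
    exact Term.of_step (.pMap₀ _) ((rRel_vals (.cons (vRel_map.2 .nil) .nil)).term hK ht)
  | sMap =>
    rcases h with _ | ⟨h₁, h₂⟩
    exact Term.of_step (.sMap _ _ _ _) ((h₁.1.mono hm.le).term
      (kRel_params .map .nil
        (forall₂_eRel_mono hm.le (.cons h₁.2 (flatten_rel h₂))) hK) ht)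

theorem eRel_cons {n : ℕ} {e₁ e₁' e₂ e₂' : Exp} (h₁ : ERel n e₁ e₁') (h₂ : ERel n e₂ e₂') :
    ERel n (.nonval (.cons e₁ e₂)) (.nonval (.cons e₁' e₂')) := by
  refine ERel.of_step ⟨h₁.scoped.1, h₂.scoped.1⟩ ⟨h₁.scoped.2, h₂.scoped.2⟩
    fun m hm K₁ K₂ K' r' hK hs ht => ?_
  cases hs
  exact Term.of_step (.sConsTail _ _ _)
    ((h₂.mono hm.le).term (kRel_consTail (h₁.mono hm.le) hK) ht)

theorem eRel_call {n : ℕ} {em em' ef ef' : Exp} {es es' : List Exp} (hm : ERel n em em')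
    (hf : ERel n ef ef') (h : List.Forall₂ (ERel n) es es') :
    ERel n (.nonval (.call em ef es)) (.nonval (.call em' ef' es')) := by
  refine ERel.of_step ⟨hm.scoped.1, hf.scoped.1, (expsScoped_of_rel h).1⟩
    ⟨hm.scoped.2, hf.scoped.2, (expsScoped_of_rel h).2⟩ fun m hmn K₁ K₂ K' r' hK hs ht => ?_
  cases hs
  exact Term.of_step (.sCallMod _ _ _ _) ((hm.mono hmn.le).term
    (kRel_callMod (hf.mono hmn.le) (forall₂_eRel_mono hmn.le h) hK) ht)

theorem eRel_app {n : ℕ} {e e' : Exp} {es es' : List Exp} (he : ERel n e e')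
    (h : List.Forall₂ (ERel n) es es') :
    ERel n (.nonval (.app e es)) (.nonval (.app e' es')) := by
  refine ERel.of_step ⟨he.scoped.1, (expsScoped_of_rel h).1⟩
    ⟨he.scoped.2, (expsScoped_of_rel h).2⟩ fun m hm K₁ K₂ K' r' hK hs ht => ?_
  cases hs
  exact Term.of_step (.sApp _ _ _)
    ((he.mono hm.le).term (kRel_app (forall₂_eRel_mono hm.le h) hK) ht)

theorem eRel_case {n : ℕ} {e e' : Exp} {cls cls' : List Clause} (he : ERel n e e')
    (h : List.Forall₂ (ClauseRel n) cls cls') :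
    ERel n (.nonval (.case e cls)) (.nonval (.case e' cls')) := by
  refine ERel.of_step ⟨he.scoped.1, (clausesScoped_of_rel h).1⟩
    ⟨he.scoped.2, (clausesScoped_of_rel h).2⟩ fun m hm K₁ K₂ K' r' hK hs ht => ?_
  cases hs
  exact Term.of_step (.sCase _ _ _)
    ((he.mono hm.le).term (kRel_case (h.imp fun _ _ h => h.mono hm.le) hK) ht)

theorem eRel_letIn {n : ℕ} {xs : List Var} {e₁ e₁' e₂ e₂' : Exp} (h₁ : ERel n e₁ e₁')
    (h₂ : BodyRel n (varNames xs) e₂ e₂') :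
    ERel n (.nonval (.letIn xs e₁ e₂)) (.nonval (.letIn xs e₁' e₂')) := by
  refine ERel.of_step ⟨h₁.scoped.1, h₂.1⟩ ⟨h₁.scoped.2, h₂.2.1⟩
    fun m hm K₁ K₂ K' r' hK hs ht => ?_
  cases hs
  exact Term.of_step (.sLet _ _ _ _)
    ((h₁.mono hm.le).term (kRel_letIn (h₂.mono hm.le) hK) ht)

theorem eRel_seq {n : ℕ} {e₁ e₁' e₂ e₂' : Exp} (h₁ : ERel n e₁ e₁') (h₂ : ERel n e₂ e₂') :
    ERel n (.nonval (.seq e₁ e₂)) (.nonval (.seq e₁' e₂')) := by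
  refine ERel.of_step ⟨h₁.scoped.1, h₂.scoped.1⟩ ⟨h₁.scoped.2, h₂.scoped.2⟩
    fun m hm K₁ K₂ K' r' hK hs ht => ?_
  cases hs
  exact Term.of_step (.sSeq _ _ _)
    ((h₁.mono hm.le).term (kRel_seq (h₂.mono hm.le) hK) ht)

theorem eRel_tryCatch {n : ℕ} {xs ys : List Var} {e₁ e₁' e₂ e₂' e₃ e₃' : Exp}
    (h₁ : ERel n e₁ e₁') (h₂ : BodyRel n (varNames xs) e₂ e₂')
    (h₃ : BodyRel n (varNames ys) e₃ e₃') :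
    ERel n (.nonval (.tryCatch e₁ xs e₂ ys e₃)) (.nonval (.tryCatch e₁' xs e₂' ys e₃')) := by
  refine ERel.of_step ⟨h₁.scoped.1, h₂.1, h₃.1⟩ ⟨h₁.scoped.2, h₂.2.1, h₃.2.1⟩
    fun m hm K₁ K₂ K' r' hK hs ht => ?_
  cases hs
  exact Term.of_step (.sTry _ _ _ _ _ _)
    ((h₁.mono hm.le).term (kRel_tryCatch (h₂.mono hm.le) (h₃.mono hm.le) hK) ht)

theorem map_fst_mkClosList (ext : List ClosItem) :
    (mkClosList ext).map Prod.fst = namesOf ext := by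
  rw [mkClosList, namesOf, List.map_map]
  exact List.map_congr_left fun c _ => by cases c; rfl

theorem eRel_letrec {n : ℕ} {ext ext' : List ClosItem} {e e' : Exp}
    (hext : extScoped ext (extend ∅ (namesOf ext)))
    (hext' : extScoped ext' (extend ∅ (namesOf ext)))
    (hrel : List.Forall₂ (BindRel n) (mkClosList ext) (mkClosList ext'))
    (he : BodyRel n (namesOf ext) e e') :
    ERel n (.nonval (.letrec ext e)) (.nonval (.letrec ext' e')) := by
  have hn : namesOf ext' = namesOf ext := by
    rw [← map_fst_mkClosList, ← map_fst_mkClosList, BindRel.map_fst_eq hrel]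
  refine ERel.of_step ⟨hext, he.1⟩ ⟨by rwa [hn], by rw [hn]; exact he.2.1⟩
    fun m hm K₁ K₂ K' r' hK hs ht => ?_
  cases hs
  exact Term.of_step (.pLetRec _ _ _) ((he.subst_ofList hm.le
    (hrel.imp fun _ _ h => ⟨h.1, h.2.mono hm.le⟩) (map_fst_mkClosList ext)).term hK ht)

/-! ### Binders and closures under related substitutions -/

/-- The substitution that agrees with `τ` on the names `ns` and with `σ` elsewhere. -/
def Subst.override (σ : Subst) (ns : List Name) (τ : Subst) : Subst :=
  fun x => if x ∈ ns then τ x else σ x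

theorem Subst.Scoped.isComp_override {σ : Subst} {Γ : Set Name} (h : σ.Scoped Γ ∅)
    (ns : List Name) (τ : Subst) :
    Subst.IsComp (extend Γ ns) (σ.hide ns) τ (σ.override ns τ) := by
  intro x hx
  by_cases hn : x ∈ ns
  · exact Or.inl ⟨Subst.hide_of_mem hn, if_pos hn⟩
  · rw [Subst.hide_of_notMem hn]
    exact Or.inr ⟨h x (hx.resolve_right hn), if_neg hn⟩

theorem GRel.override {Γ : Set Name} {n : ℕ} {ns : List Name} {σ₁ σ₂ τ₁ τ₂ : Subst}
    (hσ : GRel Γ n σ₁ σ₂) (hτ : GRel (extend ∅ ns) n τ₁ τ₂) :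
    GRel (extend Γ ns) n (σ₁.override ns τ₁) (σ₂.override ns τ₂) := by
  refine GRel.of_vRel fun x hx => ?_
  unfold Subst.override
  split_ifs with hn
  · exact hτ.2.2 x (Or.inr hn)
  · exact hσ.2.2 x (hx.resolve_right hn)

/-- Substituting under a binder and instantiating the bound names afterwards amounts to a single
substitution on the extended scope. -/
theorem ERelOpen.bodyRel {Γ : Set Name} {ns : List Name} {e : Exp}
    (hs : e.Scoped (extend Γ ns)) (h : ERelOpen (extend Γ ns) e e) {n : ℕ} {σ₁ σ₂ : Subst}
    (hσ : GRel Γ n σ₁ σ₂) : BodyRel n ns (e.subst (σ₁.hide ns)) (e.subst (σ₂.hide ns)) := by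
  refine ⟨hs.subst (hσ.1.closes.hide ns), hs.subst (hσ.2.1.closes.hide ns),
    fun m hm τ₁ τ₂ hτ => ?_⟩
  rw [Exp.subst_subst (hσ.1.isComp_override ns τ₁) hs,
    Exp.subst_subst (hσ.2.1.isComp_override ns τ₂) hs]
  exact h m _ _ ((hσ.mono hm).override hτ)

/-- Substituting in the definitions of a collection and forming the closures commute. -/
theorem mkClosList_extSubst (ext : List ClosItem) (σ : Subst) :
    mkClosList (extSubst ext (σ.hide (namesOf ext))) =
      (mkClosList ext).map fun p => (p.1, p.2.subst σ) := by
  -- each closure carries all of `ext`, so that the induction is on a second copy of the list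
  have key : ∀ l : List ClosItem,
      (extSubst l (σ.hide (namesOf ext))).map (fun
        | .mk f xs e => (Name.fid f xs.length,
            Val.clos (extSubst ext (σ.hide (namesOf ext))) xs e)) =
      (l.map fun | .mk f xs e => (Name.fid f xs.length, Val.clos ext xs e)).map
        fun p => (p.1, p.2.subst σ) := by
    intro l
    induction l with
    | nil => rfl
    | cons c l ih =>
      cases c
      simp only [extSubst, List.map_cons, ih, Val.subst]
  exact key ext

theorem mkClosList_rel {n : ℕ} {ext : List ClosItem} {σ₁ σ₂ : Subst}
    (h : ∀ f xs e, ClosItem.mk f xs e ∈ ext →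
      VRel n ((Val.clos ext xs e).subst σ₁) ((Val.clos ext xs e).subst σ₂)) :
    List.Forall₂ (BindRel n) (mkClosList (extSubst ext (σ₁.hide (namesOf ext))))
      (mkClosList (extSubst ext (σ₂.hide (namesOf ext)))) := by
  rw [mkClosList_extSubst, mkClosList_extSubst, List.forall₂_map_left_iff,
    List.forall₂_map_right_iff, List.forall₂_same]
  intro p hp
  obtain ⟨⟨f, xs, e⟩, hc, rfl⟩ := List.mem_map.1 hp
  exact ⟨rfl, h f xs e hc⟩

/-- Closures with the recursive definitions `ext` are related to themselves if the bodies of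
`ext` are. The proof is by induction on the step index: the body of a closure sees the closures
of `ext` only at smaller indices. -/
theorem vRel_clos_self {Γ : Set Name} {ext : List ClosItem}
    (hs : extScoped ext (extend Γ (namesOf ext)))
    (hext : ∀ f xs e, ClosItem.mk f xs e ∈ ext →
      e.Scoped (extend (extend Γ (namesOf ext)) (varNames xs)) ∧
        ERelOpen (extend (extend Γ (namesOf ext)) (varNames xs)) e e)
    {n : ℕ} {σ₁ σ₂ : Subst} (hσ : GRel Γ n σ₁ σ₂) (xs : List Var) (e : Exp)
    (he : e.Scoped (extend (extend Γ (namesOf ext)) (varNames xs)))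
    (hr : ERelOpen (extend (extend Γ (namesOf ext)) (varNames xs)) e e) :
    VRel n ((Val.clos ext xs e).subst σ₁) ((Val.clos ext xs e).subst σ₂) := by
  induction n using Nat.strong_induction_on generalizing xs e with
  | _ n ih =>
    have hc : (Val.clos ext xs e).Scoped Γ := ⟨hs, he⟩
    have hc₁ := hc.subst (hσ.1.closes (Δ := ∅))
    have hc₂ := hc.subst (hσ.2.1.closes (Δ := ∅))
    simp only [Val.subst] at hc₁ hc₂ ⊢
    refine vRel_clos.2 ⟨hc₁, hc₂, rfl, fun m hm vs vs' hl _ hv => ?_⟩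
    rw [extend_extend] at he hr
    simp only [Subst.hide_hide]
    refine (hr.bodyRel he (hσ.mono hm.le)).subst_ofList le_rfl (List.rel_append
      (mkClosList_rel fun f ys b hb => ih m hm (hσ.mono hm.le) ys b (hext f ys b hb).1
        (hext f ys b hb).2) (bindVars_rel hv xs)) ?_
    rw [List.map_append, map_fst_mkClosList, map_fst_bindVars hl.symm, namesOf_extSubst]

/-! ### The fundamental property -/

mutual

theorem Exp.Scoped.eRelOpen {Γ : Set Name} : ∀ {e : Exp}, e.Scoped Γ → ERelOpen Γ e e
  | .val _, h => fun n _ _ hσ => eRel_val (Val.Scoped.vRelOpen h n _ _ hσ)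
  | .nonval _, h => NonVal.Scoped.eRelOpen h

theorem Val.Scoped.vRelOpen {Γ : Set Name} : ∀ {v : Val}, v.Scoped Γ → VRelOpen Γ v v
  | .int i, _ => fun _ _ _ _ => vRel_int i
  | .atom a, _ => fun _ _ _ _ => vRel_atom a
  | .nil, _ => fun _ _ _ _ => vRel_nil_left.2 rfl
  | .var _, h => fun _ _ _ hσ => hσ.2.2 _ h
  | .fid _ _, h => fun _ _ _ hσ => hσ.2.2 _ h
  | .cons _ _, h => fun n _ _ hσ =>
    vRel_cons.2 ⟨Val.Scoped.vRelOpen h.1 n _ _ hσ, Val.Scoped.vRelOpen h.2 n _ _ hσ⟩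
  | .tuple _, h => fun _ _ _ hσ => vRel_tuple.2 (valsSubst_rel h hσ)
  | .map _, h => fun _ _ _ hσ => vRel_map.2 (valPairsSubst_rel h hσ)
  | .clos _ xs e, h => fun _ _ _ hσ =>
    vRel_clos_self h.1 (ext_eRelOpen h.1) hσ xs e h.2 (Exp.Scoped.eRelOpen h.2)

theorem NonVal.Scoped.eRelOpen {Γ : Set Name} : ∀ {e : NonVal}, e.Scoped Γ →
    ERelOpen Γ (.nonval e) (.nonval e)
  | .func xs e, h => fun n σ₁ σ₂ hσ => by
    -- the function evaluates to a closure without recursive definitions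
    have he : e.Scoped (extend (extend Γ (namesOf [])) (varNames xs)) := by
      rw [extend_extend]
      exact h
    have hr : ERelOpen (extend (extend Γ (namesOf [])) (varNames xs)) e e := by
      rw [extend_extend]
      exact Exp.Scoped.eRelOpen h
    have hc := vRel_clos_self (ext := []) trivial (fun _ _ _ h => by simp at h) hσ xs e he hr
    simp only [Val.subst, extSubst, Subst.hide_hide] at hc
    exact eRel_func hc
  | .values _, h => fun _ _ _ hσ => eRel_values (expsSubst_rel h hσ)
  | .cons _ _, h => fun n _ _ hσ =>
    eRel_cons (Exp.Scoped.eRelOpen h.1 n _ _ hσ) (Exp.Scoped.eRelOpen h.2 n _ _ hσ)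
  | .tuple _, h => fun _ _ _ hσ => eRel_tuple (expsSubst_rel h hσ)
  | .map _, h => fun _ _ _ hσ => eRel_map (expPairsSubst_rel h hσ)
  | .call _ _ _, h => fun n _ _ hσ =>
    eRel_call (Exp.Scoped.eRelOpen h.1 n _ _ hσ) (Exp.Scoped.eRelOpen h.2.1 n _ _ hσ)
      (expsSubst_rel h.2.2 hσ)
  | .primop a _, h => fun _ _ _ hσ => eRel_primop a (expsSubst_rel h hσ)
  | .app _ _, h => fun n _ _ hσ =>
    eRel_app (Exp.Scoped.eRelOpen h.1 n _ _ hσ) (expsSubst_rel h.2 hσ)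
  | .case _ _, h => fun n _ _ hσ =>
    eRel_case (Exp.Scoped.eRelOpen h.1 n _ _ hσ) (clausesSubst_rel h.2 hσ)
  | .letIn _ _ _, h => fun n _ _ hσ =>
    eRel_letIn (Exp.Scoped.eRelOpen h.1 n _ _ hσ) ((Exp.Scoped.eRelOpen h.2).bodyRel h.2 hσ)
  | .seq _ _, h => fun n _ _ hσ =>
    eRel_seq (Exp.Scoped.eRelOpen h.1 n _ _ hσ) (Exp.Scoped.eRelOpen h.2 n _ _ hσ)
  | .letrec ext e, h => fun n σ₁ σ₂ hσ => by
    have hext := ext_eRelOpen h.1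
    have hn := namesOf_extSubst ext (σ₁.hide (namesOf ext))
    refine eRel_letrec ?_ ?_ (mkClosList_rel fun f xs e hc =>
      vRel_clos_self h.1 hext hσ xs e (hext f xs e hc).1 (hext f xs e hc).2) ?_ <;> rw [hn]
    · exact extScoped_subst (hσ.1.closes.hide _) h.1
    · exact extScoped_subst (hσ.2.1.closes.hide _) h.1
    · exact (Exp.Scoped.eRelOpen h.2).bodyRel h.2 hσ
  | .tryCatch _ _ _ _ _, h => fun n _ _ hσ =>
    eRel_tryCatch (Exp.Scoped.eRelOpen h.1 n _ _ hσ)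
      ((Exp.Scoped.eRelOpen h.2.1).bodyRel h.2.1 hσ)
      ((Exp.Scoped.eRelOpen h.2.2).bodyRel h.2.2 hσ)

theorem expsSubst_rel {Γ : Set Name} {n : ℕ} {σ₁ σ₂ : Subst} :
    ∀ {es : List Exp}, expsScoped es Γ → GRel Γ n σ₁ σ₂ →
      List.Forall₂ (ERel n) (expsSubst es σ₁) (expsSubst es σ₂)
  | [], _, _ => .nil
  | _ :: _, h, hσ => .cons (Exp.Scoped.eRelOpen h.1 n _ _ hσ) (expsSubst_rel h.2 hσ)

theorem expPairsSubst_rel {Γ : Set Name} {n : ℕ} {σ₁ σ₂ : Subst} :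
    ∀ {kvs : List (Exp × Exp)}, expPairsScoped kvs Γ → GRel Γ n σ₁ σ₂ →
      List.Forall₂ (ExpPairRel n) (expPairsSubst kvs σ₁) (expPairsSubst kvs σ₂)
  | [], _, _ => .nil
  | (_, _) :: _, h, hσ =>
    .cons ⟨Exp.Scoped.eRelOpen h.1 n _ _ hσ, Exp.Scoped.eRelOpen h.2.1 n _ _ hσ⟩
      (expPairsSubst_rel h.2.2 hσ)

theorem valsSubst_rel {Γ : Set Name} {n : ℕ} {σ₁ σ₂ : Subst} :
    ∀ {vs : List Val}, valsScoped vs Γ → GRel Γ n σ₁ σ₂ →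
      List.Forall₂ (VRel n) (valsSubst vs σ₁) (valsSubst vs σ₂)
  | [], _, _ => .nil
  | _ :: _, h, hσ => .cons (Val.Scoped.vRelOpen h.1 n _ _ hσ) (valsSubst_rel h.2 hσ)

theorem valPairsSubst_rel {Γ : Set Name} {n : ℕ} {σ₁ σ₂ : Subst} :
    ∀ {kvs : List (Val × Val)}, valPairsScoped kvs Γ → GRel Γ n σ₁ σ₂ →
      List.Forall₂ (PairRel n) (valPairsSubst kvs σ₁) (valPairsSubst kvs σ₂)
  | [], _, _ => .nil
  | (_, _) :: _, h, hσ =>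
    .cons ⟨Val.Scoped.vRelOpen h.1 n _ _ hσ, Val.Scoped.vRelOpen h.2.1 n _ _ hσ⟩
      (valPairsSubst_rel h.2.2 hσ)

theorem ext_eRelOpen {Γ : Set Name} : ∀ {ext : List ClosItem}, extScoped ext Γ →
    ∀ f xs e, ClosItem.mk f xs e ∈ ext →
      e.Scoped (extend Γ (varNames xs)) ∧ ERelOpen (extend Γ (varNames xs)) e e
  | [], _ => fun _ _ _ hc => by simp at hc
  | .mk _ _ _ :: _, h => fun f xs e hc => by
    have hhead := Exp.Scoped.eRelOpen h.1
    have htail := ext_eRelOpen h.2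
    rcases List.mem_cons.1 hc with hc | hc
    · cases hc
      exact ⟨h.1, hhead⟩
    · exact htail f xs e hc

theorem clausesSubst_rel {Γ : Set Name} {n : ℕ} {σ₁ σ₂ : Subst} :
    ∀ {cls : List Clause}, clausesScoped cls Γ → GRel Γ n σ₁ σ₂ →
      List.Forall₂ (ClauseRel n) (clausesSubst cls σ₁) (clausesSubst cls σ₂)
  | [], _, _ => .nil
  | .mk _ _ _ :: _, h, hσ =>
    .cons (.mk ((Exp.Scoped.eRelOpen h.1).bodyRel h.1 hσ)
      ((Exp.Scoped.eRelOpen h.2.1).bodyRel h.2.1 hσ)) (clausesSubst_rel h.2.2 hσ)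

end

theorem Exc.Scoped.xRelOpen {Γ : Set Name} {x : Exc} (h : x.Scoped Γ) : XRelOpen Γ x x :=
  fun n _ _ hσ => xRel_iff.2 ⟨rfl, h.1.vRelOpen n _ _ hσ, h.2.vRelOpen n _ _ hσ⟩

theorem Redex.Scoped.rRelOpen {Γ : Set Name} : ∀ {r : Redex}, r.Scoped Γ → RRelOpen Γ r r
  | .vals _, h => fun _ _ _ hσ => rRel_vals (valsSubst_rel h hσ)
  | .exc _, h => fun n _ _ hσ => rRel_exc (Exc.Scoped.xRelOpen h n _ _ hσ)
  | .exp _, h => fun n _ _ hσ => eRel_iff_rRel.1 (Exp.Scoped.eRelOpen h n _ _ hσ)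
  | .box, _ => fun _ _ _ _ => rRel_box

/-- A closed value is not changed by a substitution, so that the fundamental property relates it
to itself. -/
theorem VRel.refl_of_closed {v : Val} (h : v.Scoped ∅) (n : ℕ) : VRel n v v := by
  have := h.vRelOpen n Val.ofName Val.ofName (GRel.of_vRel fun _ hx => hx.elim)
  rwa [Val.subst_of_closed h] at this

end CoreErlang

theorem mainTheorem4 (Γ : Set CoreErlang.Name) :
    (∀ e : CoreErlang.Exp, e.Scoped Γ → CoreErlang.ERelOpen Γ e e) ∧
    (∀ v : CoreErlang.Val, v.Scoped Γ → CoreErlang.VRelOpen Γ v v) ∧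
    (∀ x : CoreErlang.Exc, x.Scoped Γ → CoreErlang.XRelOpen Γ x x) ∧
    (∀ r : CoreErlang.Redex, r.Scoped Γ → CoreErlang.RRelOpen Γ r r) ∧
    (∀ σ : CoreErlang.Subst, σ.Scoped Γ ∅ → ∀ n : ℕ, CoreErlang.GRel Γ n σ σ) :=
  ⟨fun _ h => h.eRelOpen, fun _ h => h.vRelOpen, fun _ h => h.xRelOpen, fun _ h => h.rRelOpen,
    fun _ h n => CoreErlang.GRel.of_vRel fun x hx => CoreErlang.VRel.refl_of_closed (h x hx) n⟩
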